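/- **Setting.** Let $G=(V,\mathcal E)$ be a finite simple graph and $E(x)=\sum_{i\in V}\Theta_i(x_i)+\sum_{ij\in\mathcal E}\Theta_{ij}(x_i,x_j)$, $x\in\{0,1\}^V$, a real-valued energy that is submodular: $\Theta_{ij}(0,0)+\Theta_{ij}(1,1)\le\Theta_{ij}(0,1)+\Theta_{ij}(1,0)$ for every edge. An energy is *canonical* if $\Theta_{ij}(0,0)=\Theta_{ij}(1,1)=0$ and $\theta^{01}_{ij}:=\Theta_{ij}(0,1)\ge0$, $\Theta_{ij}(1,0)\ge0$ for all edges, and for all $i$ the numbers $\theta_i^a:=\Theta_i(a)$ are nonnegative and at least one of $\theta_i^0,\theta_i^1$ is $0$. A canonical form of $E$ is a canonical energy on $G$ that differs from $E$ by an additive constant. **Messages.** Messages are vectors indexed by $\{0,1\}$, each normalized by subtracting its smaller entry. *Strict MP* updates all messages in parallel from the old ones: $m_{\Theta_i\to x_i}=\Theta_i$; $m_{x_i\to\Theta_{ij}}=m_{\Theta_i\to x_i}+\sum_{k\in N(i)\setminus\{j\}}m_{\Theta_{ki}\to x_i}$; $m_{\Theta_{ij}\to x_j}(x_j)=\min_{x_i}[\Theta_{ij}(x_i,x_j)+m_{x_i\to\Theta_{ij}}(x_i)]$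 (all up to normalization). A *max-product (MP) fixed point* is a fixed point of Strict MP. The beliefs are $b_i=\Theta_i+\sum_{k\in N(i)}m_{\Theta_{ki}\to x_i}$. An assignment $x$ is *decoded* from them if $x_i\in\arg\min b_i$ for all $i$ and ties are broken consistently: $x_i=x_j$ whenever $b_i$ and $b_j$ are both tied and $ij$ is an edge with $\Theta_{ij}(0,0)+\Theta_{ij}(1,1)<\Theta_{ij}(0,1)+\Theta_{ij}(1,0)$. (Giving label $0$ to all tied variables is one such choice.) The fixed point is *optimal* if every assignment decoded from it has minimum energy. **APMP** on a canonical energy. All messages start at $0$. Put $r_{ij}=\theta_{ij}^{01}-m_{x_i\to\Theta_{ij}}(1)+m_{x_i\to\Theta_{ij}}(0)$, $r_{si}=\theta_i^1-m_{\Theta_i\to x_i}(1)$, $r_{it}=\theta_i^0-m_{\Theta_i\to x_i}(0)$. An *augmenting path* is a path $v_1,\dots,v_n$ ($n\ge 1$) in $G$ without repeated vertices for which the bottleneck capacity $f=\min(r_{sv_1},r_{v_1v_2},\dots,r_{v_{n-1}v_n},r_{v_nt})$ is positive. *Phase 1*: as long as there is an augmenting path, a scheduler, which may depend on the history of the run,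 chooses one. Messages are passed along it forward and then backward, all others being held fixed. The forward pass starts with the damped message $\lambda m_{\Theta_{v_1}\to x_{v_1}}+(1-\lambda)\Theta_{v_1}$, where $\lambda=\frac{\theta_{v_1}^1-f-b}{\theta_{v_1}^1-b}$ and $b=m_{\Theta_{v_1}\to x_{v_1}}(1)$. The backward pass starts with the analogous message of $\Theta_{v_n}$, with $\theta_{v_n}^0$ and $b=m_{\Theta_{v_n}\to x_{v_n}}(0)$. All other messages on the chain are undamped. *Phase 2*: when there is no augmenting path, Strict MP is iterated from the current messages. **Theorem (Guaranteed Convergence and Optimality of the APMP Fixed Point).** Let $E$ be a submodular energy as above. 1. $E$ has a canonical form. For every canonical form $C$ of $E$: - (a) A scheduler that always chooses an augmenting path with the fewest edges exists, and with any such scheduler Phase 1 of APMP on $C$ ends after finitely many iterations. If all potentials of $C$ are rational, Phase 1 ends after finitely many iterations with every scheduler. - (b) With every scheduler for which Phase 1 ends, APMP reaches an MP fixed point of $C$ after finitely many iterations and stays there. This fixed point is optimal: an assignment can be decoded from it, and every assignment decoded from it minimizes $C$, and hence $E$. 2. In particular, $E$ itself has an optimal MP fixed point. -/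

import Mathlib

/-- A graph-structured energy over binary variables (`false` is the label `0`, `true` the label `1`)
on a simple graph: unary potentials `Θ_i` and, for each edge `ij`, a pairwise potential `Θ_ij`.
The latter is stored once for each of the two orientations of the edge: `pair (i, j) a b` is
`Θ_ij (a, b)`, and `pair (j, i) b a` is the same number. -/
structure PairwiseEnergy {V : Type*} (G : SimpleGraph V) where
  unary : V → Bool → ℝ
  pair : G.Dart → Bool → Bool → ℝ
  pair_symm : ∀ d a b, pair d.symm b a = pair d a b

/-- The state of message passing. `unary i` is the message `Θ_i → x_i`; for an oriented edge
`d = (i, j)`, `toFactor d` is the message `x_i → Θ_ij` and `toVar d` is the message `Θ_ij → x_j`. -/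
@[ext] structure Messages {V : Type*} (G : SimpleGraph V) where
  unary : V → Bool → ℝ
  toFactor : G.Dart → Bool → ℝ
  toVar : G.Dart → Bool → ℝ

/-- A chain subgraph: a path (no repeated vertex) of the graph, from `first` to `last`. -/
structure Chain {V : Type*} (G : SimpleGraph V) where
  first : V
  last : V
  walk : G.Walk first last
  isPath : walk.IsPath

/-- All messages equal to `0`. -/
noncomputable def zeroMessages {V : Type*} (G : SimpleGraph V) : Messages G where
  unary := fun _ _ => 0
  toFactor := fun _ _ => 0
  toVar := fun _ _ => 0

/-- Message normalization: subtract a constant so that the smaller entry becomes `0`. -/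
noncomputable def normalizeMsg (μ : Bool → ℝ) : Bool → ℝ :=
  fun a => μ a - min (μ false) (μ true)

namespace PairwiseEnergy

section Energy

variable {V : Type*} [Fintype V] [DecidableEq V] {G : SimpleGraph V} [DecidableRel G.Adj]

/-- The energy of an assignment. Every edge is the edge of exactly two darts, which contribute the
same value; hence the factor `1 / 2`. -/
noncomputable def energy (E : PairwiseEnergy G) (x : V → Bool) : ℝ :=
  ∑ i, E.unary i (x i) + (1 / 2) * ∑ d : G.Dart, E.pair d (x d.fst) (x d.snd)

/-- Submodularity of the pairwise potentials. -/
def IsSubmodular (E : PairwiseEnergy G) : Prop :=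
  ∀ d, E.pair d false false + E.pair d true true ≤ E.pair d false true + E.pair d true false

/-- The normal form: nonnegative pairwise potentials with zero diagonal, and nonnegative unary
potentials at least one of whose two entries is `0`. -/
def IsCanonical (E : PairwiseEnergy G) : Prop :=
  (∀ d, E.pair d false false = 0 ∧ E.pair d true true = 0 ∧
    0 ≤ E.pair d false true ∧ 0 ≤ E.pair d true false) ∧
  ∀ i, 0 ≤ E.unary i false ∧ 0 ≤ E.unary i true ∧ (E.unary i false = 0 ∨ E.unary i true = 0)

/-- `C` and `E` give every assignment the same energy, up to one additive constant. -/
def IsReparametrization (C E : PairwiseEnergy G) : Prop :=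
  ∃ c : ℝ, ∀ x, E.energy x = C.energy x + c

/-- `x` is a minimum-energy assignment. -/
def IsMinimizer (E : PairwiseEnergy G) (x : V → Bool) : Prop :=
  ∀ y, E.energy x ≤ E.energy y

/-- All potentials take rational values only. -/
def IsRational (E : PairwiseEnergy G) : Prop :=
  (∀ i a, ∃ q : ℚ, E.unary i a = (q : ℝ)) ∧ ∀ d a b, ∃ q : ℚ, E.pair d a b = (q : ℝ)

/-! ### Max-product (min-sum) message updates -/

/-- The undamped, normalized message `Θ_i → x_i`. -/
noncomputable def unaryUpdate (E : PairwiseEnergy G) (i : V) : Bool → ℝ :=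
  normalizeMsg (E.unary i)

/-- For `d = (i, j)`, the normalized message `x_i → Θ_ij`: the sum of all messages into `x_i`,
except the one from `Θ_ij`. -/
noncomputable def toFactorUpdate (_E : PairwiseEnergy G) (m : Messages G) (d : G.Dart) : Bool → ℝ :=
  normalizeMsg fun a =>
    m.unary d.fst a + ∑ e : G.Dart with e.snd = d.fst ∧ e ≠ d.symm, m.toVar e a

/-- For `d = (i, j)`, the normalized message `Θ_ij → x_j`:
`x_j ↦ min over x_i of Θ_ij (x_i, x_j) + (message x_i → Θ_ij) (x_i)`. -/
noncomputable def toVarUpdate (E : PairwiseEnergy G) (m : Messages G) (d : G.Dart) : Bool → ℝ :=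
  normalizeMsg fun b =>
    min (E.pair d false b + m.toFactor d false) (E.pair d true b + m.toFactor d true)

/-- One iteration of Strict MP: all messages are updated in parallel, from the old messages. -/
noncomputable def strictMP (E : PairwiseEnergy G) (m : Messages G) : Messages G where
  unary := E.unaryUpdate
  toFactor := E.toFactorUpdate m
  toVar := E.toVarUpdate m

/-- A max-product fixed point: a fixed point of Strict MP. -/
def IsMPFixedPoint (E : PairwiseEnergy G) (m : Messages G) : Prop :=
  E.strictMP m = m

/-- The belief at `x_i`. -/
noncomputable def belief (E : PairwiseEnergy G) (m : Messages G) (i : V) (a : Bool) : ℝ :=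
  E.unary i a + ∑ e : G.Dart with e.snd = i, m.toVar e a

/-- `x` is decoded from the beliefs: `x_i` minimizes the belief at `i`, and ties are broken
consistently, that is, two variables with tied beliefs get the same label if they are joined by an
edge whose potential satisfies the submodularity inequality strictly (in normal form: an edge whose
potential is not identically `0`). -/
def IsDecoding (E : PairwiseEnergy G) (m : Messages G) (x : V → Bool) : Prop :=
  (∀ i a, E.belief m i (x i) ≤ E.belief m i a) ∧
  ∀ d : G.Dart,
    E.belief m d.fst false = E.belief m d.fst true →
    E.belief m d.snd false = E.belief m d.snd true →
    E.pair d false false + E.pair d true true < E.pair d false true + E.pair d true false →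
    x d.fst = x d.snd

/-- A max-product fixed point whose beliefs decode to minimum-energy assignments. -/
def IsOptimalFixedPoint (E : PairwiseEnergy G) (m : Messages G) : Prop :=
  E.IsMPFixedPoint m ∧ (∃ x, E.IsDecoding m x) ∧ ∀ x, E.IsDecoding m x → E.IsMinimizer x

/-! ### Residual capacities and augmenting paths -/

/-- `r_ij = θ_ij^01 - m_{x_i → Θ_ij}(1) + m_{x_i → Θ_ij}(0)` for `d = (i, j)`. -/
noncomputable def residual (E : PairwiseEnergy G) (m : Messages G) (d : G.Dart) : ℝ :=
  E.pair d false true - m.toFactor d true + m.toFactor d false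

/-- `r_si = θ_i^1 - m_{Θ_i → x_i}(1)`. -/
noncomputable def residualSource (E : PairwiseEnergy G) (m : Messages G) (i : V) : ℝ :=
  E.unary i true - m.unary i true

/-- `r_it = θ_i^0 - m_{Θ_i → x_i}(0)`. -/
noncomputable def residualSink (E : PairwiseEnergy G) (m : Messages G) (i : V) : ℝ :=
  E.unary i false - m.unary i false

/-- The bottleneck capacity: the smallest residual capacity of an edge on the path
`s, first, …, last, t`. -/
noncomputable def bottleneck (E : PairwiseEnergy G) (m : Messages G) (T : Chain G) : ℝ :=
  (T.walk.darts.map (E.residual m)).foldr min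
    (min (E.residualSink m T.last) (E.residualSource m T.first))

/-- The path `s, first, …, last, t` has positive capacity. -/
def IsAugmenting (E : PairwiseEnergy G) (m : Messages G) (T : Chain G) : Prop :=
  0 < E.bottleneck m T

/-! ### Phase 1: message passing on one chain -/

/-- Send the message `Θ_i → x_i`, damped with parameter `l`. -/
noncomputable def sendUnary (E : PairwiseEnergy G) (l : ℝ) (m : Messages G) (i : V) : Messages G :=
  { m with
    unary := Function.update m.unary i
      (normalizeMsg fun a => l * m.unary i a + (1 - l) * E.unary i a) }

/-- For `d = (i, j)`, send (undamped) the message `x_i → Θ_ij` and then the message `Θ_ij → x_j`. -/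
noncomputable def sendDart (E : PairwiseEnergy G) (m : Messages G) (d : G.Dart) : Messages G :=
  let m' : Messages G := { m with toFactor := Function.update m.toFactor d (E.toFactorUpdate m d) }
  { m' with toVar := Function.update m'.toVar d (E.toVarUpdate m' d) }

/-- The damping parameter of the first unary factor: it turns the entry `b` of the old message into
`b + f`, where `f` is the bottleneck capacity. -/
noncomputable def dampingFirst (E : PairwiseEnergy G) (m : Messages G) (T : Chain G) : ℝ :=
  (E.unary T.first true - E.bottleneck m T - m.unary T.first true) /
    (E.unary T.first true - m.unary T.first true)

/-- The damping parameter of the last unary factor. -/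
noncomputable def dampingLast (E : PairwiseEnergy G) (m : Messages G) (T : Chain G) : ℝ :=
  (E.unary T.last false - E.bottleneck m T - m.unary T.last false) /
    (E.unary T.last false - m.unary T.last false)

/-- One iteration of Phase 1 on the chain `T`: messages are passed forward and then backward along
`T`, starting with the damped message of the unary factor at the end in question; all other
messages are held fixed. -/
noncomputable def passChain (E : PairwiseEnergy G) (m : Messages G) (T : Chain G) : Messages G :=
  let m₁ := E.sendUnary (E.dampingFirst m T) m T.first
  let m₂ := T.walk.darts.foldl E.sendDart m₁
  let m₃ := E.sendUnary (E.dampingLast m T) m₂ T.last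
  T.walk.reverse.darts.foldl E.sendDart m₃

/-! ### The algorithm -/

/-- A scheduler returns an augmenting path for the current messages if there is one, and `none` if
there is none. It may depend on the iteration (and so on the history of the run). -/
def IsScheduler (E : PairwiseEnergy G) (S : ℕ → Messages G → Option (Chain G)) : Prop :=
  ∀ t m, (∀ T, S t m = some T → E.IsAugmenting m T) ∧
    (S t m = none → ∀ T, ¬ E.IsAugmenting m T)

/-- The scheduler only returns augmenting paths with the fewest possible edges. -/
def IsShortestPath (E : PairwiseEnergy G) (S : ℕ → Messages G → Option (Chain G)) : Prop :=
  ∀ t m T, S t m = some T → ∀ T', E.IsAugmenting m T' → T.walk.length ≤ T'.walk.length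

/-- Augmenting Paths Max-Product, from zero messages. The state after `t` iterations consists of the
messages and a flag that tells whether Phase 2 has been entered. In Phase 1 messages are passed on
the chain which the scheduler returns; when it returns none, Phase 2 (Strict MP) begins. -/
noncomputable def apmp (E : PairwiseEnergy G) (S : ℕ → Messages G → Option (Chain G)) :
    ℕ → Messages G × Bool
  | 0 => (zeroMessages G, false)
  | t + 1 =>
    match apmp E S t with
    | (m, true) => (E.strictMP m, true)
    | (m, false) =>
      match S t m with
      | some T => (E.passChain m T, false)
      | none => (m, true)

/-- Phase 1 ends after finitely many iterations. -/
def Phase1Terminates (E : PairwiseEnergy G) (S : ℕ → Messages G → Option (Chain G)) : Prop :=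
  ∃ t, (E.apmp S t).2 = true

end Energy

end PairwiseEnergy

/-! A normalized binary message is determined by the difference of its two entries, so every update
becomes arithmetic of one real number per dart. For a canonical energy, `toVarUpdate_eq` says that a
factor truncates this number to the interval between minus the capacity of the reverse dart and the
capacity of the dart.

Phase 1 is max-flow in disguise. The invariant `IsFlow` says that both messages on a dart carry the
flow along it. Zero excess at every variable is then flow conservation. By `IsFlow.passChain_eq`, a
forward and a backward pass augment this flow by the bottleneck capacity. Termination is the
Edmonds–Karp argument for shortest paths (`progress_passChain_lt`) and a common denominator for
rational potentials.

In Phase 2 there is no augmenting path, so no vertex is both reachable from the source and able to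
reach the sink in the residual graph. The messages stay equal to the flow plus a shift whose sign
depends only on the side of the vertex. Evidence of opposite signs never meets, and the magnitudes
of the shifts evolve under a monotone map (`strictMP_phase2Messages`). They increase, are bounded by
residual capacities, and lie in a finitely generated submonoid of the nonnegative reals. Such a
submonoid has finitely many elements below any bound, so the iteration stops rather than merely
converging.

At the fixed point the beliefs are strict on the two sides and tied elsewhere. Since the energy is a
constant plus the capacity of the residual cut (`energy_eq`), and a decoded assignment cuts no
residual edge, it is a minimizer. For the original energy, the fixed point of its canonical form is
carried back by adjusting each message by the unary part that was moved out of the pairwise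
potential. -/

set_option linter.unusedSectionVars false

/-! ### Normalized messages as real numbers. -/

/-- The normalized message whose entries differ by `z`. -/
noncomputable def ofDiff (z : ℝ) : Bool → ℝ := fun a => if a then max z 0 else max (-z) 0

theorem ofDiff_true (z : ℝ) : ofDiff z true = max z 0 := rfl

theorem ofDiff_false (z : ℝ) : ofDiff z false = max (-z) 0 := by simp [ofDiff]

theorem ofDiff_sub (z : ℝ) : ofDiff z true - ofDiff z false = z := by
  rw [ofDiff_true, ofDiff_false]
  rcases le_total 0 z with h | h
  · rw [max_eq_left h, max_eq_right (by linarith)]; ring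
  · rw [max_eq_right h, max_eq_left (by linarith)]; ring

theorem normalizeMsg_eq_ofDiff (μ : Bool → ℝ) :
    normalizeMsg μ = ofDiff (μ true - μ false) := by
  funext a
  rcases le_total (μ false) (μ true) with h | h
  · cases a
    · rw [ofDiff_false, normalizeMsg, min_eq_left h, max_eq_right (by linarith)]; ring
    · rw [ofDiff_true, normalizeMsg, min_eq_left h, max_eq_left (by linarith)]
  · cases a
    · rw [ofDiff_false, normalizeMsg, min_eq_right h, max_eq_left (by linarith)]; ring
    · rw [ofDiff_true, normalizeMsg, min_eq_right h, max_eq_right (by linarith)]; ring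

theorem ofDiff_eq_self {μ : Bool → ℝ} (h0 : 0 ≤ μ false) (h1 : 0 ≤ μ true)
    (h : μ false = 0 ∨ μ true = 0) : ofDiff (μ true - μ false) = μ := by
  funext a
  rcases h with h | h <;> cases a <;> simp [ofDiff, h, h0, h1]

theorem normalizeMsg_nonneg (μ : Bool → ℝ) : 0 ≤ normalizeMsg μ false ∧ 0 ≤ normalizeMsg μ true ∧
    (normalizeMsg μ false = 0 ∨ normalizeMsg μ true = 0) := by
  simp only [normalizeMsg]
  refine ⟨sub_nonneg.2 (min_le_left _ _), sub_nonneg.2 (min_le_right _ _), ?_⟩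
  rcases min_choice (μ false) (μ true) with h | h <;> rw [h] <;> simp

/-! ### Message updates in terms of the excess at a variable. -/

namespace Messages

variable {V : Type*} [Fintype V] [DecidableEq V] {G : SimpleGraph V} [DecidableRel G.Adj]

/-- The preference of the messages into `x_i` for the label `0`. -/
noncomputable def excess (m : Messages G) (i : V) : ℝ :=
  m.unary i true - m.unary i false +
    ∑ e : G.Dart with e.snd = i, (m.toVar e true - m.toVar e false)

theorem sum_snd_eq_add {i : V} (d : G.Dart) (hd : d.fst = i) (g : G.Dart → ℝ) :
    ∑ e : G.Dart with e.snd = i, g e =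
      g d.symm + ∑ e : G.Dart with e.snd = i ∧ e ≠ d.symm, g e := by
  have h : d.symm ∈ ({e : G.Dart | e.snd = i} : Finset G.Dart) := by simp [hd]
  rw [← Finset.add_sum_erase _ _ h]
  congr 1
  apply Finset.sum_congr _ (fun _ _ => rfl)
  ext e
  simp [and_comm]

theorem excess_congr {m m' : Messages G} {i : V} {c : ℝ}
    (hu : m'.unary i true - m'.unary i false = m.unary i true - m.unary i false + c)
    (hv : ∀ e : G.Dart, e.snd = i → m'.toVar e = m.toVar e) : m'.excess i = m.excess i + c := by
  rw [excess, excess, hu]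
  have : ∑ e : G.Dart with e.snd = i, (m'.toVar e true - m'.toVar e false) =
      ∑ e : G.Dart with e.snd = i, (m.toVar e true - m.toVar e false) := by
    apply Finset.sum_congr rfl
    intro e he
    rw [hv e (by simpa using he)]
  rw [this]; ring

end Messages

namespace PairwiseEnergy

variable {V : Type*} [Fintype V] [DecidableEq V] {G : SimpleGraph V} [DecidableRel G.Adj]

theorem pair_true_false (E : PairwiseEnergy G) (d : G.Dart) :
    E.pair d true false = E.pair d.symm false true := (E.pair_symm d true false).symm

/-- Only the reverse message is left out of the sum, so a single number per variable, its excess,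
controls all of its outgoing messages. -/
theorem toFactorUpdate_eq (E : PairwiseEnergy G) (m : Messages G) (d : G.Dart) :
    E.toFactorUpdate m d =
      ofDiff (m.excess d.fst - (m.toVar d.symm true - m.toVar d.symm false)) := by
  rw [toFactorUpdate, normalizeMsg_eq_ofDiff, Messages.excess,
    Messages.sum_snd_eq_add d rfl, Finset.sum_sub_distrib]
  congr 1
  ring

/-- With a zero diagonal, copying the label is free and changing it costs a capacity. Minimizing
over the other label therefore truncates the preference at the two capacities of the edge. -/
theorem toVarUpdate_eq {C : PairwiseEnergy G} (hC : C.IsCanonical) {m : Messages G} {d : G.Dart}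
    {z : ℝ} (h : m.toFactor d = ofDiff z) :
    C.toVarUpdate m d = ofDiff (max (-C.pair d.symm false true) (min z (C.pair d false true))) := by
  obtain ⟨h00, h11, h01, h10⟩ := hC.1 d
  rw [toVarUpdate, normalizeMsg_eq_ofDiff, h, h00, h11, pair_true_false] at *
  congr 1
  rw [ofDiff_true, ofDiff_false]
  rcases le_total 0 z with hz | hz
  · rw [max_eq_left hz, max_eq_right (show -z ≤ 0 by linarith),
      min_eq_left (show (0:ℝ) + 0 ≤ _ by linarith),
      max_eq_right (show - C.pair d.symm false true ≤ _ by
        have := le_min hz h01; linarith), min_comm]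
    simp
  · rw [max_eq_right hz, max_eq_left (show 0 ≤ -z by linarith),
      min_eq_right (show (0:ℝ) + 0 ≤ _ by linarith), min_eq_left (show z ≤ _ by linarith)]
    rcases le_total (-z) (C.pair d.symm false true) with h' | h'
    · rw [min_eq_left (by linarith), max_eq_right (by linarith)]; ring
    · rw [min_eq_right (by linarith), max_eq_left (by linarith)]; ring

/-- The effect of passing messages along a path all of whose vertices but the first have the same
excess. -/
theorem foldl_sendDart_eq {C : PairwiseEnergy G} (hC : C.IsCanonical) {h δ : ℝ} {u w : V}
    (p : G.Walk u w) (hp : p.IsPath) (m : Messages G) (φ : G.Dart → ℝ)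
    (hφ : ∀ d ∈ p.darts, m.toVar d = ofDiff (φ d))
    (hu : m.excess u = h + δ) (hx : ∀ x ∈ p.support, x ≠ u → m.excess x = h)
    (hsymm : ∀ d ∈ p.darts, m.toVar d true - m.toVar d false +
      (m.toVar d.symm true - m.toVar d.symm false) = h)
    (hlo : ∀ d ∈ p.darts, -C.pair d.symm false true ≤ φ d + δ)
    (hhi : ∀ d ∈ p.darts, φ d + δ ≤ C.pair d false true) :
    p.darts.foldl C.sendDart m =
      { unary := m.unary
        toFactor := fun d => if d ∈ p.darts then ofDiff (φ d + δ) else m.toFactor d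
        toVar := fun d => if d ∈ p.darts then ofDiff (φ d + δ) else m.toVar d } := by
  induction p generalizing m with
  | nil => simp
  | @cons u v w a p ih =>
    rw [SimpleGraph.Walk.cons_isPath_iff] at hp
    obtain ⟨hp, hup⟩ := hp
    set d₀ : G.Dart := ⟨(u, v), a⟩ with hd₀
    have hmem : d₀ ∈ (SimpleGraph.Walk.cons a p).darts := by simp [hd₀]
    -- The path does not return to `u`, so the message sent on `d₀` is neither changed nor used as a
    -- reverse message later on.
    have hne : ∀ d ∈ p.darts, d ≠ d₀ ∧ d.symm ≠ d₀ := by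
      intro d hd
      refine ⟨?_, ?_⟩
      · rintro rfl
        exact hup (p.dart_fst_mem_support_of_mem_darts hd)
      · intro he
        apply hup
        have := p.dart_snd_mem_support_of_mem_darts hd
        have h2 : d.symm.fst = u := by rw [he]
        rwa [← h2]
    have hself : d₀.symm ≠ d₀ := d₀.symm_ne
    have hstep : C.sendDart m d₀ =
        { unary := m.unary
          toFactor := Function.update m.toFactor d₀ (ofDiff (φ d₀ + δ))
          toVar := Function.update m.toVar d₀ (ofDiff (φ d₀ + δ)) } := by
      -- The excess is `h + δ`, and by `hsymm` the reverse message is `h - φ d₀`. The bounds `hlo`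
      -- and `hhi` then make the truncation inactive.
      have h1 : C.toFactorUpdate m d₀ = ofDiff (φ d₀ + δ) := by
        rw [toFactorUpdate_eq]
        have h2 := hsymm d₀ hmem
        rw [hφ d₀ hmem, ofDiff_sub] at h2
        have h3 : m.excess d₀.fst = h + δ := hu
        rw [h3]
        congr 1
        linarith
      simp only [sendDart]
      rw [toVarUpdate_eq hC (z := φ d₀ + δ), min_eq_left (hhi d₀ hmem), max_eq_right (hlo d₀ hmem),
        h1]
      simp [h1]
    have hd' : (SimpleGraph.Walk.cons a p).darts = d₀ :: p.darts := rfl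
    rw [hd', List.foldl_cons, hstep]
    have hsub : ∀ d ∈ p.darts, d ∈ (SimpleGraph.Walk.cons a p).darts := by
      intro d hd; rw [hd']; exact List.mem_cons_of_mem _ hd
    set m' : Messages G :=
        { unary := m.unary
          toFactor := Function.update m.toFactor d₀ (ofDiff (φ d₀ + δ))
          toVar := Function.update m.toVar d₀ (ofDiff (φ d₀ + δ)) } with hm'
    have hvar : ∀ d, d ≠ d₀ → m'.toVar d = m.toVar d := by
      intro d hd; simp [hm', hd]
    have hex : ∀ x, x ≠ v → m'.excess x = m.excess x := by
      intro x hx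
      simp only [Messages.excess]
      congr 1
      apply Finset.sum_congr rfl
      intro e he
      rw [hvar]
      rintro rfl
      simp [hd₀] at he
      exact hx he.symm
    -- The surplus `δ` has moved on to `v`, which now plays the role of `u` in the induction.
    have hv : m'.excess v = h + δ := by
      have h1 : m.excess v = h := hx v (by simp) (fun h => a.ne h.symm)
      rw [← h1]
      simp only [Messages.excess]
      have e1 : d₀.symm.fst = v := rfl
      rw [Messages.sum_snd_eq_add d₀.symm e1, Messages.sum_snd_eq_add d₀.symm e1,
        SimpleGraph.Dart.symm_symm]
      have h2 : ∑ e : G.Dart with e.snd = v ∧ e ≠ d₀, (m'.toVar e true - m'.toVar e false) =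
          ∑ e : G.Dart with e.snd = v ∧ e ≠ d₀, (m.toVar e true - m.toVar e false) := by
        apply Finset.sum_congr rfl
        intro e he
        rw [hvar e (by simp at he; exact he.2)]
      rw [h2, hφ d₀ hmem, ofDiff_sub]
      have : m'.toVar d₀ = ofDiff (φ d₀ + δ) := by simp [hm']
      rw [this, ofDiff_sub]
      ring
    rw [ih hp m' ?_ hv ?_ ?_ (fun d hd => hlo d (hsub d hd)) (fun d hd => hhi d (hsub d hd))]
    · ext d b
      · rfl
      · by_cases h1 : d ∈ p.darts
        · simp [h1]
        · by_cases h2 : d = d₀ <;> simp [h1, h2, hm']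
      · by_cases h1 : d ∈ p.darts
        · simp [h1]
        · by_cases h2 : d = d₀ <;> simp [h1, h2, hm']
    · intro d hd
      rw [hvar d (hne d hd).1, hφ d (hsub d hd)]
    · intro x hxp hxv
      rw [hex x hxv]
      apply hx x (by simp [hxp])
      rintro rfl
      exact hup hxp
    · intro d hd
      rw [hvar d (hne d hd).1, hvar d.symm (hne d hd).2]
      exact hsymm d (hsub d hd)

end PairwiseEnergy

/-! ### Darts of a path. -/

namespace SimpleGraph.Walk

theorem IsPath.symm_notMem_darts {V : Type*} {G : SimpleGraph V} {u w : V} {p : G.Walk u w}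
    (hp : p.IsPath) {d : G.Dart} (hd : d ∈ p.darts) : d.symm ∉ p.darts := by
  induction p with
  | nil => simp at hd
  | @cons u v w a p ih =>
    rw [cons_isPath_iff] at hp
    intro hs
    rw [darts_cons, List.mem_cons] at hd hs
    rcases hd with rfl | hd
    · rcases hs with hs | hs
      · exact Dart.symm_ne _ hs
      · exact hp.2 (p.dart_snd_mem_support_of_mem_darts hs)
    · rcases hs with hs | hs
      · have := p.dart_snd_mem_support_of_mem_darts hd
        have h2 : d.symm.fst = u := by rw [hs]
        exact hp.2 (h2 ▸ this)
      · exact ih hp.1 hd hs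

/-- A path enters each of its vertices exactly once, except the first, which it never enters. -/
theorem IsPath.sum_darts_snd_eq {V : Type*} [Fintype V] [DecidableEq V] {G : SimpleGraph V}
    [DecidableRel G.Adj] {u w : V} {p : G.Walk u w} (hp : p.IsPath) (f : ℝ) (x : V) :
    ∑ e : G.Dart with e.snd = x, (if e ∈ p.darts then f else 0) =
      if x ∈ p.support ∧ x ≠ u then f else 0 := by
  induction p with
  | nil =>
    simp
  | @cons u v w a p ih =>
    rw [cons_isPath_iff] at hp
    obtain ⟨hp, hup⟩ := hp
    have h1 : ∀ e : G.Dart, (if e ∈ (cons a p).darts then f else 0) =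
        (if e = ⟨(u, v), a⟩ then f else 0) + (if e ∈ p.darts then f else 0) := by
      intro e
      rw [darts_cons]
      by_cases he : e = ⟨(u, v), a⟩
      · have : e ∉ p.darts := by
          rintro h
          rw [he] at h
          exact hup (p.dart_fst_mem_support_of_mem_darts h)
        simp [he] at this ⊢
        simp [this]
      · simp [he]
    simp_rw [h1]
    rw [Finset.sum_add_distrib, ih hp]
    rw [Finset.sum_ite_eq']
    have hv : v ∈ p.support := p.start_mem_support
    by_cases hx : x = v
    · subst hx
      have : x ≠ u := fun h => hup (h ▸ hv)
      simp [this]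
    · by_cases hxu : x = u
      · subst hxu
        simp [hup, Ne.symm hx]
      · simp [hx, hxu, Ne.symm hx]

end SimpleGraph.Walk

/-! ### Phase 1 as flow augmentation. -/

namespace PairwiseEnergy

variable {V : Type*} [Fintype V] [DecidableEq V] {G : SimpleGraph V} [DecidableRel G.Adj]

/-- The messages `m` encode the flow which sends `φ d` along the dart `d`, and `m.unary i true` and
`m.unary i false` along the edges from the source to `i` and from `i` to the sink. -/
structure IsFlow (C : PairwiseEnergy G) (m : Messages G) (φ : G.Dart → ℝ) : Prop where
  symm : ∀ d, φ d.symm = -φ d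
  le_cap : ∀ d, φ d ≤ C.pair d false true
  toFactor_eq : ∀ d, m.toFactor d = ofDiff (φ d)
  toVar_eq : ∀ d, m.toVar d = ofDiff (φ d)
  unary_nonneg : ∀ i a, 0 ≤ m.unary i a
  unary_le : ∀ i a, m.unary i a ≤ C.unary i a
  conserve : ∀ i, m.unary i true - m.unary i false + ∑ e : G.Dart with e.snd = i, φ e = 0

namespace IsFlow

variable {C : PairwiseEnergy G} {m : Messages G} {φ : G.Dart → ℝ}

theorem excess_eq (h : C.IsFlow m φ) (i : V) : m.excess i = 0 := by
  rw [← h.conserve i, Messages.excess]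
  simp_rw [h.toVar_eq, ofDiff_sub]

theorem residual_eq (h : C.IsFlow m φ) (d : G.Dart) :
    C.residual m d = C.pair d false true - φ d := by
  rw [residual, h.toFactor_eq]
  linarith [ofDiff_sub (φ d)]

theorem residual_nonneg (h : C.IsFlow m φ) (d : G.Dart) : 0 ≤ C.residual m d := by
  rw [h.residual_eq]; linarith [h.le_cap d]

end IsFlow

theorem isFlow_zero {C : PairwiseEnergy G} (hC : C.IsCanonical) :
    C.IsFlow (zeroMessages G) fun _ => 0 where
  symm := by simp
  le_cap d := (hC.1 d).2.2.1
  toFactor_eq d := by funext a; simp [zeroMessages, ofDiff]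
  toVar_eq d := by funext a; simp [zeroMessages, ofDiff]
  unary_nonneg i a := le_rfl
  unary_le i a := by
    cases a
    · exact (hC.2 i).1
    · exact (hC.2 i).2.1
  conserve i := by simp [zeroMessages]

theorem foldr_min_le_init {ι : Type*} (l : List ι) (g : ι → ℝ) (a : ℝ) :
    (l.map g).foldr min a ≤ a := by
  induction l with
  | nil => simp
  | cons i l ih => exact (min_le_right _ _).trans ih

theorem foldr_min_le_of_mem {ι : Type*} {l : List ι} (g : ι → ℝ) (a : ℝ) {i : ι} (hi : i ∈ l) :
    (l.map g).foldr min a ≤ g i := by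
  induction l with
  | nil => simp at hi
  | cons j l ih =>
    rcases List.mem_cons.1 hi with rfl | hi
    · exact min_le_left _ _
    · exact (min_le_right _ _).trans (ih hi)

theorem foldr_min_eq {ι : Type*} (l : List ι) (g : ι → ℝ) (a : ℝ) :
    (l.map g).foldr min a = a ∨ ∃ i ∈ l, (l.map g).foldr min a = g i := by
  induction l with
  | nil => simp
  | cons j l ih =>
    simp only [List.map_cons, List.foldr_cons]
    rcases min_choice (g j) ((l.map g).foldr min a) with h | h
    · exact Or.inr ⟨j, by simp, h⟩
    · rw [h]
      rcases ih with h' | ⟨i, hi, h'⟩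
      · exact Or.inl h'
      · exact Or.inr ⟨i, by simp [hi], h'⟩

theorem bottleneck_le_source (E : PairwiseEnergy G) (m : Messages G) (T : Chain G) :
    E.bottleneck m T ≤ E.residualSource m T.first :=
  (foldr_min_le_init _ _ _).trans (min_le_right _ _)

theorem bottleneck_le_sink (E : PairwiseEnergy G) (m : Messages G) (T : Chain G) :
    E.bottleneck m T ≤ E.residualSink m T.last :=
  (foldr_min_le_init _ _ _).trans (min_le_left _ _)

theorem bottleneck_le_residual (E : PairwiseEnergy G) (m : Messages G) (T : Chain G) {d : G.Dart}
    (hd : d ∈ T.walk.darts) : E.bottleneck m T ≤ E.residual m d :=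
  foldr_min_le_of_mem _ _ hd

theorem bottleneck_eq (E : PairwiseEnergy G) (m : Messages G) (T : Chain G) :
    E.bottleneck m T = E.residualSource m T.first ∨ E.bottleneck m T = E.residualSink m T.last ∨
      ∃ d ∈ T.walk.darts, E.bottleneck m T = E.residual m d := by
  rcases foldr_min_eq T.walk.darts (E.residual m)
    (min (E.residualSink m T.last) (E.residualSource m T.first)) with h | h
  · rcases min_choice (E.residualSink m T.last) (E.residualSource m T.first) with h' | h'
    · exact Or.inr (Or.inl (h.trans h'))
    · exact Or.inl (h.trans h')
  · exact Or.inr (Or.inr h)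

theorem isAugmenting_iff (E : PairwiseEnergy G) (m : Messages G) (T : Chain G) :
    E.IsAugmenting m T ↔ 0 < E.residualSource m T.first ∧ 0 < E.residualSink m T.last ∧
      ∀ d ∈ T.walk.darts, 0 < E.residual m d := by
  constructor
  · intro h
    exact ⟨h.trans_le (E.bottleneck_le_source m T), h.trans_le (E.bottleneck_le_sink m T),
      fun d hd => h.trans_le (E.bottleneck_le_residual m T hd)⟩
  · rintro ⟨h1, h2, h3⟩
    rw [IsAugmenting]
    rcases E.bottleneck_eq m T with h | h | ⟨d, hd, h⟩
    · rwa [h]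
    · rwa [h]
    · rw [h]; exact h3 d hd

/-- The flow after `f` units have been sent along the walk `p`. -/
noncomputable def augmentFlow (φ : G.Dart → ℝ) (f : ℝ) {u w : V} (p : G.Walk u w) (d : G.Dart) :
    ℝ :=
  φ d + (if d ∈ p.darts then f else 0) - (if d.symm ∈ p.darts then f else 0)

variable {C : PairwiseEnergy G} {m : Messages G} {φ : G.Dart → ℝ} {T : Chain G}

theorem IsFlow.first_unary_false (hC : C.IsCanonical) (h : C.IsFlow m φ)
    (hT : C.IsAugmenting m T) : C.unary T.first false = 0 := by
  have h1 := ((C.isAugmenting_iff m T).1 hT).1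
  have h2 := h.unary_nonneg T.first true
  rw [residualSource] at h1
  exact (hC.2 T.first).2.2.resolve_right (by linarith)

theorem IsFlow.last_unary_true (hC : C.IsCanonical) (h : C.IsFlow m φ)
    (hT : C.IsAugmenting m T) : C.unary T.last true = 0 := by
  have h1 := ((C.isAugmenting_iff m T).1 hT).2.1
  have h2 := h.unary_nonneg T.last false
  rw [residualSink] at h1
  exact (hC.2 T.last).2.2.resolve_left (by linarith)

/-- One of the two unary entries at a vertex is zero, so no vertex has residual capacity both from
the source and to the sink. In particular, the two damped unary messages of a pass belong to
different variables. -/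
theorem IsFlow.first_ne_last (hC : C.IsCanonical) (h : C.IsFlow m φ) (hT : C.IsAugmenting m T) :
    T.first ≠ T.last := by
  intro he
  have h0 := h.first_unary_false hC hT
  have h1 := ((C.isAugmenting_iff m T).1 hT).2.1
  have h2 := h.unary_nonneg T.last false
  rw [residualSink, ← he] at h1
  rw [← he] at h2
  linarith

/-- One iteration of Phase 1 augments the flow along the chain by the bottleneck capacity. -/
theorem IsFlow.passChain_eq (hC : C.IsCanonical) (h : C.IsFlow m φ) (hT : C.IsAugmenting m T) :
    C.passChain m T =
      { unary := fun i a => m.unary i a +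
          (if i = T.first ∧ a = true then C.bottleneck m T else 0) +
          (if i = T.last ∧ a = false then C.bottleneck m T else 0)
        toFactor := fun d => ofDiff (augmentFlow φ (C.bottleneck m T) T.walk d)
        toVar := fun d => ofDiff (augmentFlow φ (C.bottleneck m T) T.walk d) } := by
  have hne := h.first_ne_last hC hT
  obtain ⟨hs, ht, hr⟩ := (C.isAugmenting_iff m T).1 hT
  have hf0 := h.first_unary_false hC hT
  have hl1 := h.last_unary_true hC hT
  have hmf0 : m.unary T.first false = 0 :=
    le_antisymm (hf0 ▸ h.unary_le T.first false) (h.unary_nonneg _ _)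
  have hml1 : m.unary T.last true = 0 :=
    le_antisymm (hl1 ▸ h.unary_le T.last true) (h.unary_nonneg _ _)
  have hfpos : 0 < C.bottleneck m T := hT
  have hfd : ∀ d ∈ T.walk.darts, C.bottleneck m T ≤ C.pair d false true - φ d := fun d hd => by
    rw [← h.residual_eq]; exact C.bottleneck_le_residual m T hd
  rw [residualSource] at hs
  rw [residualSink] at ht
  have hcap : ∀ d, 0 ≤ C.pair d false true := fun d => (hC.1 d).2.2.1
  have hφlo : ∀ d, -C.pair d.symm false true ≤ φ d := fun d => by
    have := h.le_cap d.symm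
    rw [h.symm] at this; linarith
  simp only [passChain]
  set f := C.bottleneck m T with hf
  -- the forward pass
  have hm1 : C.sendUnary (C.dampingFirst m T) m T.first =
      { m with unary := Function.update m.unary T.first (ofDiff (m.unary T.first true + f)) } := by
    rw [sendUnary, normalizeMsg_eq_ofDiff, hf0, hmf0, dampingFirst]
    congr 4
    rw [← hf]
    field_simp [hs.ne']
    ring
  rw [hm1]
  set m₁ : Messages G :=
    { m with unary := Function.update m.unary T.first (ofDiff (m.unary T.first true + f)) }
    with hm₁
  have hex1 : ∀ x, m₁.excess x = if x = T.first then f else 0 := by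
    intro x
    rw [Messages.excess_congr (m := m) (m' := m₁) (c := if x = T.first then f else 0) ?_ (fun _ _ => rfl),
      h.excess_eq, zero_add]
    by_cases hx : x = T.first
    · subst hx
      simp only [hm₁, Function.update_self, ofDiff_sub, hmf0]
      simp
    · simp [hm₁, hx]
  -- All excesses were `0`, and the new unary message creates an excess `f` at the first vertex,
  -- which travels along the chain.
  have hfold1 := foldl_sendDart_eq hC (h := 0) (δ := f) T.walk T.isPath m₁ φ
    (fun d _ => h.toVar_eq d) (by simp [hex1]) (fun x _ hx => by simp [hex1, hx])
    (fun d _ => by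
      show m.toVar d true - m.toVar d false + (m.toVar d.symm true - m.toVar d.symm false) = 0
      rw [h.toVar_eq, h.toVar_eq, ofDiff_sub, ofDiff_sub, h.symm]; ring)
    (fun d _ => by linarith [hφlo d]) (fun d hd => by linarith [hfd d hd])
  rw [hfold1]
  -- the backward pass
  set m₂ : Messages G :=
      { unary := m₁.unary
        toFactor := fun d => if d ∈ T.walk.darts then ofDiff (φ d + f) else m₁.toFactor d
        toVar := fun d => if d ∈ T.walk.darts then ofDiff (φ d + f) else m₁.toVar d } with hm₂
  have hlast : m₂.unary T.last = m.unary T.last := by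
    simp [hm₂, hm₁, hne.symm]
  have hm3 : C.sendUnary (C.dampingLast m T) m₂ T.last =
      { m₂ with
        unary := Function.update m₂.unary T.last (ofDiff (-(m.unary T.last false + f))) } := by
    rw [sendUnary, normalizeMsg_eq_ofDiff, hlast, hl1, hml1, dampingLast]
    congr 4
    rw [← hf]
    field_simp [ht.ne']
    ring
  rw [hm3]
  set m₃ : Messages G :=
    { m₂ with unary := Function.update m₂.unary T.last (ofDiff (-(m.unary T.last false + f))) }
    with hm₃
  have hvar2 : ∀ d, m₂.toVar d true - m₂.toVar d false =
      φ d + if d ∈ T.walk.darts then f else 0 := by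
    intro d
    simp only [hm₂]
    by_cases hd : d ∈ T.walk.darts
    · simp only [hd, if_true, ofDiff_sub]
    · simp only [hd, if_false]
      rw [show m₁.toVar d = m.toVar d from rfl, h.toVar_eq, ofDiff_sub, add_zero]
  -- The first vertex gained `f` from its unary message, every other vertex of the chain from the
  -- one dart that enters it.
  have hex2 : ∀ x ∈ T.walk.support, m₂.excess x = f := by
    intro x hx
    have h1 := hex1 x
    rw [Messages.excess] at h1 ⊢
    simp_rw [hvar2, Finset.sum_add_distrib, T.isPath.sum_darts_snd_eq]
    have h2 : ∑ e : G.Dart with e.snd = x, (m₁.toVar e true - m₁.toVar e false) =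
        ∑ e : G.Dart with e.snd = x, φ e := by
      apply Finset.sum_congr rfl
      intro e _
      rw [show m₁.toVar e = m.toVar e from rfl, h.toVar_eq, ofDiff_sub]
    rw [h2] at h1
    rw [show m₂.unary = m₁.unary from rfl, ← add_assoc, h1]
    by_cases hxf : x = T.first <;> simp [hxf, hx]
  have hex3 : ∀ x ∈ T.walk.support, m₃.excess x = if x = T.last then 0 else f := by
    intro x hx
    rw [Messages.excess_congr (m := m₂) (m' := m₃) (c := if x = T.last then -f else 0) ?_ (fun _ _ => rfl),
      hex2 x hx]
    · by_cases hxl : x = T.last <;> simp [hxl]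
    · by_cases hxl : x = T.last
      · subst hxl
        rw [hlast]
        simp only [hm₃, Function.update_self, ofDiff_sub, hml1]
        simp; ring
      · simp [hm₃, hxl]
  -- Now the common excess is `f`, and the sink message has lowered that of the last vertex to `0`.
  -- This deficit travels back and lowers the reverse messages by `f`, which restores antisymmetry.
  have hfold2 := foldl_sendDart_eq hC (h := f) (δ := -f) T.walk.reverse
    T.isPath.reverse m₃ φ
    (fun d hd => by
      rw [SimpleGraph.Walk.mem_darts_reverse] at hd
      have := T.isPath.symm_notMem_darts hd
      rw [SimpleGraph.Dart.symm_symm] at this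
      simp only [hm₃, hm₂, this, if_false]
      exact h.toVar_eq d)
    (by rw [hex3 _ T.walk.end_mem_support]; simp)
    (fun x hx hxl => by
      rw [SimpleGraph.Walk.support_reverse, List.mem_reverse] at hx
      rw [hex3 x hx, if_neg hxl])
    (fun d hd => by
      rw [SimpleGraph.Walk.mem_darts_reverse] at hd
      have := T.isPath.symm_notMem_darts hd
      rw [SimpleGraph.Dart.symm_symm] at this
      rw [show m₃.toVar = m₂.toVar from rfl, hvar2, hvar2, if_pos hd, if_neg this, h.symm]
      ring)
    (fun d hd => by
      rw [SimpleGraph.Walk.mem_darts_reverse] at hd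
      have := hfd _ hd
      rw [h.symm] at this; linarith)
    (fun d _ => by linarith [h.le_cap d])
  rw [hfold2]
  have hmsg : ∀ (g : G.Dart → Bool → ℝ), (∀ d, g d = ofDiff (φ d)) → ∀ d,
      (if d ∈ T.walk.reverse.darts then ofDiff (φ d + -f) else
        if d ∈ T.walk.darts then ofDiff (φ d + f) else g d) =
      ofDiff (augmentFlow φ f T.walk d) := by
    intro g hg d
    rw [augmentFlow]
    by_cases hd : d.symm ∈ T.walk.darts
    · have := T.isPath.symm_notMem_darts hd
      rw [SimpleGraph.Dart.symm_symm] at this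
      rw [if_pos ((SimpleGraph.Walk.mem_darts_reverse).2 hd), if_pos hd, if_neg this]
      congr 1; ring
    · rw [if_neg (fun h => hd ((SimpleGraph.Walk.mem_darts_reverse).1 h)), if_neg hd]
      by_cases hd' : d ∈ T.walk.darts
      · simp [hd']
      · simp [hd', hg]
  refine Messages.ext ?_ ?_ ?_
  · funext i a
    by_cases hi : i = T.last
    · subst hi
      have := h.unary_nonneg T.last false
      have h3 : m₃.unary T.last = ofDiff (-(m.unary T.last false + f)) := by simp [hm₃]
      rw [show ({ unary := m₃.unary, toFactor := _, toVar := _ } : Messages G).unary T.last a =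
        m₃.unary T.last a from rfl, h3]
      cases a
      · rw [ofDiff_false, max_eq_left (by linarith)]; simp
      · rw [ofDiff_true, max_eq_right (by linarith)]; simp [hne.symm, hml1]
    · have h3 : m₃.unary i = m₁.unary i := by simp [hm₃, hm₂, hi]
      rw [show ({ unary := m₃.unary, toFactor := _, toVar := _ } : Messages G).unary i a =
        m₃.unary i a from rfl, h3]
      by_cases hi' : i = T.first
      · subst hi'
        have := h.unary_nonneg T.first true
        simp only [hm₁, Function.update_self]
        cases a
        · rw [ofDiff_false, max_eq_right (by linarith)]; simp [hi, hmf0]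
        · rw [ofDiff_true, max_eq_left (by linarith)]; simp
      · simp [hm₁, hi, hi']
  · funext d
    exact hmsg m₁.toFactor h.toFactor_eq d
  · funext d
    exact hmsg m₁.toVar h.toVar_eq d

/-- The invariant of Phase 1. The bottleneck bounds every residual used, and what enters a vertex
along the chain leaves it again, except at the two ends, where the unary messages compensate. -/
theorem IsFlow.passChain (hC : C.IsCanonical) (h : C.IsFlow m φ) (hT : C.IsAugmenting m T) :
    C.IsFlow (C.passChain m T) (augmentFlow φ (C.bottleneck m T) T.walk) := by
  have hne := h.first_ne_last hC hT
  have hf : 0 < C.bottleneck m T := hT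
  rw [h.passChain_eq hC hT]
  refine ⟨?_, ?_, fun _ => rfl, fun _ => rfl, ?_, ?_, ?_⟩
  · intro d
    rw [augmentFlow, augmentFlow, h.symm, SimpleGraph.Dart.symm_symm]; ring
  · intro d
    rw [augmentFlow]
    have h1 := h.le_cap d
    by_cases hd : d ∈ T.walk.darts
    · have := C.bottleneck_le_residual m T hd
      rw [h.residual_eq] at this
      rw [if_pos hd]
      split_ifs <;> linarith
    · rw [if_neg hd]
      split_ifs <;> linarith
  · intro i a
    have := h.unary_nonneg i a
    dsimp only
    split_ifs <;> linarith
  · intro i a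
    have h1 := h.unary_le i a
    have h2 := C.bottleneck_le_source m T
    have h3 := C.bottleneck_le_sink m T
    rw [residualSource] at h2
    rw [residualSink] at h3
    dsimp only
    by_cases hi : i = T.first
    · subst hi
      cases a <;> simp [hne] <;> linarith
    · by_cases hi' : i = T.last
      · subst hi'
        cases a <;> simp [hi] <;> linarith
      · simp [hi, hi', h1]
  · intro i
    have h1 := h.conserve i
    have h2 := T.isPath.sum_darts_snd_eq (C.bottleneck m T) i
    -- Darts entering `i` whose reverse lies on the chain are the darts by which the reversed path
    -- enters `i`.
    have h3 := T.isPath.reverse.sum_darts_snd_eq (C.bottleneck m T) i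
    simp only [SimpleGraph.Walk.mem_darts_reverse, SimpleGraph.Walk.support_reverse,
      List.mem_reverse] at h3
    simp only [augmentFlow, Finset.sum_sub_distrib, Finset.sum_add_distrib, h2, h3]
    by_cases hi : i = T.first
    · subst hi
      simp [hne] at *
      linarith
    · by_cases hi' : i = T.last
      · subst hi'
        simp [hi] at *
        linarith
      · simp [hi, hi'] at *
        linarith

theorem IsFlow.residual_passChain (hC : C.IsCanonical) (h : C.IsFlow m φ)
    (hT : C.IsAugmenting m T) (d : G.Dart) :
    C.residual (C.passChain m T) d = C.residual m d -
      (if d ∈ T.walk.darts then C.bottleneck m T else 0) +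
      (if d.symm ∈ T.walk.darts then C.bottleneck m T else 0) := by
  rw [(h.passChain hC hT).residual_eq, h.residual_eq, augmentFlow]; ring

theorem IsFlow.residualSource_passChain (hC : C.IsCanonical) (h : C.IsFlow m φ)
    (hT : C.IsAugmenting m T) (i : V) :
    C.residualSource (C.passChain m T) i = C.residualSource m i -
      (if i = T.first then C.bottleneck m T else 0) := by
  rw [residualSource, residualSource, h.passChain_eq hC hT]
  simp; ring

theorem IsFlow.residualSink_passChain (hC : C.IsCanonical) (h : C.IsFlow m φ)
    (hT : C.IsAugmenting m T) (i : V) :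
    C.residualSink (C.passChain m T) i = C.residualSink m i -
      (if i = T.last then C.bottleneck m T else 0) := by
  rw [residualSink, residualSink, h.passChain_eq hC hT]
  simp; ring

end PairwiseEnergy

/-! ### Shortest augmenting paths (Edmonds–Karp). -/

namespace PairwiseEnergy

variable {V : Type*} [Fintype V] [DecidableEq V] {G : SimpleGraph V} [DecidableRel G.Adj]
variable {C : PairwiseEnergy G} {m : Messages G} {φ : G.Dart → ℝ} {T : Chain G}

/-- The vertices that can be reached from the source through a residual edge and at most `k`
residual darts. -/
def reach (C : PairwiseEnergy G) (m : Messages G) : ℕ → Set V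
  | 0 => {i | 0 < C.residualSource m i}
  | k + 1 => {v | v ∈ reach C m k ∨ ∃ d : G.Dart, 0 < C.residual m d ∧ d.snd = v ∧
      d.fst ∈ reach C m k}

theorem reach_mono (C : PairwiseEnergy G) (m : Messages G) : Monotone (C.reach m) :=
  monotone_nat_of_le_succ fun _ _ h => Or.inl h

theorem exists_walk_of_mem_reach {k : ℕ} {v : V} (h : v ∈ C.reach m k) :
    ∃ (u : V) (p : G.Walk u v), 0 < C.residualSource m u ∧ (∀ d ∈ p.darts, 0 < C.residual m d) ∧
      p.length ≤ k := by
  induction k generalizing v with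
  | zero => exact ⟨v, .nil, h, by simp, le_rfl⟩
  | succ k ih =>
    rcases h with h | ⟨d, hd, rfl, h⟩
    · obtain ⟨u, p, h1, h2, h3⟩ := ih h
      exact ⟨u, p, h1, h2, h3.trans k.le_succ⟩
    · obtain ⟨u, p, h1, h2, h3⟩ := ih h
      refine ⟨u, p.concat d.adj, h1, ?_, by simpa using h3⟩
      intro e he
      rw [SimpleGraph.Walk.darts_concat, List.concat_eq_append, List.mem_append] at he
      rcases he with he | he
      · exact h2 e he
      · rw [List.mem_singleton] at he
        rw [he]; exact hd

/-- Removing loops keeps a subset of the darts, so residual walks are as good as residual paths. -/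
theorem exists_isAugmenting {u w : V} (p : G.Walk u w) (hu : 0 < C.residualSource m u)
    (hw : 0 < C.residualSink m w) (hp : ∀ d ∈ p.darts, 0 < C.residual m d) :
    ∃ T, C.IsAugmenting m T ∧ T.walk.length ≤ p.length :=
  ⟨⟨u, w, p.bypass, p.bypass_isPath⟩, (C.isAugmenting_iff m _).2
    ⟨hu, hw, fun d hd => hp d (p.darts_bypass_subset_darts hd)⟩, p.length_bypass_le_length⟩

/-- Splits the walk at `d`, with exact lengths so that the end piece can be spliced onto a competing
walk. The offset `j` makes the induction go through. -/
theorem exists_walk_of_mem_darts {u w : V} (p : G.Walk u w) {j : ℕ} (hu : u ∈ C.reach m j)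
    (hp : ∀ d ∈ p.darts, 0 < C.residual m d) {d : G.Dart} (hd : d ∈ p.darts) :
    ∃ (i : ℕ) (q : G.Walk d.snd w), d.fst ∈ C.reach m (j + i) ∧
      (∀ e ∈ q.darts, 0 < C.residual m e) ∧ i + 1 + q.length = p.length := by
  induction p generalizing j with
  | nil => simp at hd
  | @cons u v w a p ih =>
    have htail : ∀ e ∈ p.darts, 0 < C.residual m e := fun e he => hp e (by simp [he])
    rw [SimpleGraph.Walk.darts_cons, List.mem_cons] at hd
    rcases hd with rfl | hd
    · exact ⟨0, p, hu, htail, by simp [add_comm]⟩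
    · have hv : v ∈ C.reach m (j + 1) := Or.inr ⟨⟨(u, v), a⟩, hp _ (by simp), rfl, hu⟩
      obtain ⟨i, q, h1, h2, h3⟩ := ih hv htail hd
      refine ⟨i + 1, q, ?_, h2, ?_⟩
      · rwa [show j + (i + 1) = j + 1 + i by ring]
      · rw [SimpleGraph.Walk.length_cons, ← h3]; ring

/-- Every dart of a shortest augmenting path leads from one level set to the next. -/
theorem exists_level_of_shortest (hT : C.IsAugmenting m T)
    (hmin : ∀ T', C.IsAugmenting m T' → T.walk.length ≤ T'.walk.length) {d : G.Dart}
    (hd : d ∈ T.walk.darts) :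
    ∃ i < Fintype.card V, d.fst ∈ C.reach m i ∧ ∀ k, d.snd ∈ C.reach m k → i + 1 ≤ k := by
  obtain ⟨hs, ht, hr⟩ := (C.isAugmenting_iff m T).1 hT
  obtain ⟨i, q, h1, h2, h3⟩ := exists_walk_of_mem_darts T.walk (j := 0) hs hr hd
  rw [zero_add] at h1
  have hlen := T.isPath.length_lt
  refine ⟨i, by omega, h1, fun k hk => ?_⟩
  -- If the head were reached in fewer than `i + 1` steps, that walk followed by `q` would beat the
  -- shortest augmenting path.
  obtain ⟨u, p, hu, hp, hpk⟩ := exists_walk_of_mem_reach hk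
  obtain ⟨T', hT', hl⟩ := exists_isAugmenting (p.append q) hu ht (fun e he => by
    rw [SimpleGraph.Walk.darts_append, List.mem_append] at he
    exact he.elim (hp e) (h2 e))
  have := hmin T' hT'
  rw [SimpleGraph.Walk.length_append] at hl
  omega

theorem IsFlow.residual_pos_of_passChain (hC : C.IsCanonical) (h : C.IsFlow m φ)
    (hT : C.IsAugmenting m T) {d : G.Dart} (hd : 0 < C.residual (C.passChain m T) d) :
    0 < C.residual m d ∨ d.symm ∈ T.walk.darts := by
  have hf : 0 < C.bottleneck m T := hT
  rw [h.residual_passChain hC hT] at hd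
  by_contra! hcon
  rw [if_neg hcon.2] at hd
  split_ifs at hd <;> linarith [hcon.1]

theorem IsFlow.residualSource_pos_of_passChain (hC : C.IsCanonical) (h : C.IsFlow m φ)
    (hT : C.IsAugmenting m T) {i : V} (hi : 0 < C.residualSource (C.passChain m T) i) :
    0 < C.residualSource m i := by
  have hf : 0 < C.bottleneck m T := hT
  rw [h.residualSource_passChain hC hT] at hi
  split_ifs at hi <;> linarith

theorem IsFlow.residualSink_pos_of_passChain (hC : C.IsCanonical) (h : C.IsFlow m φ)
    (hT : C.IsAugmenting m T) {i : V} (hi : 0 < C.residualSink (C.passChain m T) i) :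
    0 < C.residualSink m i := by
  have hf : 0 < C.bottleneck m T := hT
  rw [h.residualSink_passChain hC hT] at hi
  split_ifs at hi <;> linarith

/-- Distances from the source never drop: a new residual dart is the reverse of a chain dart, so it
leads back from a higher level to a lower one. -/
theorem IsFlow.reach_passChain_subset (hC : C.IsCanonical) (h : C.IsFlow m φ)
    (hT : C.IsAugmenting m T)
    (hmin : ∀ T', C.IsAugmenting m T' → T.walk.length ≤ T'.walk.length) (k : ℕ) :
    C.reach (C.passChain m T) k ⊆ C.reach m k := by
  induction k with
  | zero => exact fun i hi => h.residualSource_pos_of_passChain hC hT hi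
  | succ k ih =>
    rintro v (hv | ⟨d, hd, rfl, hv⟩)
    · exact Or.inl (ih hv)
    · rcases h.residual_pos_of_passChain hC hT hd with hd' | hd'
      · exact Or.inr ⟨d, hd', rfl, ih hv⟩
      · obtain ⟨i, -, h1, h2⟩ := exists_level_of_shortest hT hmin hd'
        have := h2 k (ih hv)
        exact C.reach_mono m (show i ≤ k + 1 by omega) h1

/-- The pairs of a level set (below the number of vertices) and a vertex in it. -/
def levelPairs (C : PairwiseEnergy G) (m : Messages G) : Set (Fin (Fintype.card V) × V) :=
  {x | x.2 ∈ C.reach m x.1}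

/-- The residual darts that leave some level set. -/
def tightDarts (C : PairwiseEnergy G) (m : Messages G) : Set G.Dart :=
  {d | 0 < C.residual m d ∧ ∃ k < Fintype.card V, d.fst ∈ C.reach m k ∧ d.snd ∉ C.reach m k}

/-- A quantity that decreases (lexicographically) when the flow is augmented along a shortest
augmenting path. -/
noncomputable def progress (C : PairwiseEnergy G) (m : Messages G) : ℕ ×ₗ ℕ :=
  toLex ((C.levelPairs m).ncard, (C.tightDarts m).ncard +
    {i | 0 < C.residualSource m i}.ncard + {i | 0 < C.residualSink m i}.ncard)

/-- Either some distance grows, or the level sets below the number of vertices are unchanged. In the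
second case no tight dart and no source or sink edge becomes residual again, while the bottleneck
edge is saturated and drops out. -/
theorem IsFlow.progress_passChain_lt (hC : C.IsCanonical) (h : C.IsFlow m φ)
    (hT : C.IsAugmenting m T)
    (hmin : ∀ T', C.IsAugmenting m T' → T.walk.length ≤ T'.walk.length) :
    C.progress (C.passChain m T) < C.progress m := by
  have hsub := h.reach_passChain_subset hC hT hmin
  have hpairs : C.levelPairs (C.passChain m T) ⊆ C.levelPairs m := fun x hx => hsub _ hx
  rw [progress, progress, Prod.Lex.toLex_lt_toLex]
  dsimp only
  rcases hpairs.eq_or_ssubset with heq | hss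
  · right
    refine ⟨by rw [heq], ?_⟩
    have hreach : ∀ k < Fintype.card V, ∀ v, v ∈ C.reach m k → v ∈ C.reach (C.passChain m T) k := by
      intro k hk v hv
      have : ((⟨k, hk⟩, v) : Fin (Fintype.card V) × V) ∈ C.levelPairs m := hv
      rw [← heq] at this
      exact this
    have ht : C.tightDarts (C.passChain m T) ⊆ C.tightDarts m := by
      rintro d ⟨hd, k, hk, h1, h2⟩
      have h1' := hsub k h1
      have h2' : d.snd ∉ C.reach m k := fun h => h2 (hreach k hk _ h)
      refine ⟨?_, k, hk, h1', h2'⟩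
      rcases h.residual_pos_of_passChain hC hT hd with hd' | hd'
      · exact hd'
      · obtain ⟨i, -, h3, h4⟩ := exists_level_of_shortest hT hmin hd'
        have := h4 k h1'
        exact absurd (C.reach_mono m (show i ≤ k by omega) h3) h2'
    have hA : {i | 0 < C.residualSource (C.passChain m T) i} ⊆ {i | 0 < C.residualSource m i} :=
      fun i hi => h.residualSource_pos_of_passChain hC hT hi
    have hB : {i | 0 < C.residualSink (C.passChain m T) i} ⊆ {i | 0 < C.residualSink m i} :=
      fun i hi => h.residualSink_pos_of_passChain hC hT hi
    have ht' := Set.ncard_le_ncard ht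
    have hA' := Set.ncard_le_ncard hA
    have hB' := Set.ncard_le_ncard hB
    obtain ⟨hs0, ht0, hr0⟩ := (C.isAugmenting_iff m T).1 hT
    rcases C.bottleneck_eq m T with hb | hb | ⟨d, hd, hb⟩
    · have := Set.ncard_lt_ncard (hA.ssubset_of_mem_notMem (a := T.first) hs0 (by
        simp [h.residualSource_passChain hC hT, hb]))
      omega
    · have := Set.ncard_lt_ncard (hB.ssubset_of_mem_notMem (a := T.last) ht0 (by
        simp [h.residualSink_passChain hC hT, hb]))
      omega
    -- The bottleneck dart is tight before, because it leaves level `i`. Its reverse is not on the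
    -- chain, so its residual becomes exactly `0`.
    · have := Set.ncard_lt_ncard (ht.ssubset_of_mem_notMem (a := d) (by
        obtain ⟨i, hi, h3, h4⟩ := exists_level_of_shortest hT hmin hd
        refine ⟨hr0 d hd, i, hi, h3, fun h5 => ?_⟩
        have := h4 i h5
        omega) (by
        rintro ⟨hd', -⟩
        rw [h.residual_passChain hC hT, if_pos hd, if_neg (T.isPath.symm_notMem_darts hd), hb] at hd'
        linarith))
      omega
  · left
    exact Set.ncard_lt_ncard hss

/-! ### The run of the algorithm -/

theorem exists_scheduler (C : PairwiseEnergy G) :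
    ∃ S : ℕ → Messages G → Option (Chain G), C.IsScheduler S ∧ C.IsShortestPath S := by
  classical
  have key : ∀ m : Messages G, ∃ o : Option (Chain G), (∀ T, o = some T → C.IsAugmenting m T ∧
      ∀ T', C.IsAugmenting m T' → T.walk.length ≤ T'.walk.length) ∧
      (o = none → ∀ T, ¬ C.IsAugmenting m T) := by
    intro m
    by_cases h : ∃ T, C.IsAugmenting m T
    · obtain ⟨T, hT, hmin⟩ := (measure fun T : Chain G => T.walk.length).wf.has_min
        {T | C.IsAugmenting m T} h
      exact ⟨some T, fun T₁ hT₁ => by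
        cases hT₁; exact ⟨hT, fun T' hT' => not_lt.1 (hmin T' hT')⟩, by simp⟩
    · exact ⟨none, by simp, fun _ T hT => h ⟨T, hT⟩⟩
  choose o ho using key
  exact ⟨fun _ m => o m, fun _ m => ⟨fun T hT => ((ho m).1 T hT).1, (ho m).2⟩,
    fun _ m T hT => ((ho m).1 T hT).2⟩

variable {S : ℕ → Messages G → Option (Chain G)}

theorem apmp_succ_of_some {t : ℕ} (ht : (C.apmp S t).2 = false)
    (hT : S t (C.apmp S t).1 = some T) :
    C.apmp S (t + 1) = (C.passChain (C.apmp S t).1 T, false) := by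
  rw [apmp]
  rcases h : C.apmp S t with ⟨m, b⟩
  rw [h] at ht hT
  subst ht
  simp only at hT
  simp [hT]

theorem apmp_succ_of_none {t : ℕ} (ht : (C.apmp S t).2 = false)
    (hT : S t (C.apmp S t).1 = none) : C.apmp S (t + 1) = ((C.apmp S t).1, true) := by
  rw [apmp]
  rcases h : C.apmp S t with ⟨m, b⟩
  rw [h] at ht hT
  subst ht
  simp only at hT
  simp [hT]

theorem apmp_succ_of_true {t : ℕ} (ht : (C.apmp S t).2 = true) :
    C.apmp S (t + 1) = (C.strictMP (C.apmp S t).1, true) := by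
  rw [apmp]
  rcases h : C.apmp S t with ⟨m, b⟩
  rw [h] at ht
  subst ht
  rfl

theorem bottleneck_mem {H : AddSubgroup ℝ} (hu : ∀ i a, C.unary i a ∈ H)
    (hp : ∀ d a b, C.pair d a b ∈ H) (h : C.IsFlow m φ) (hφ : ∀ d, φ d ∈ H)
    (hm : ∀ i a, m.unary i a ∈ H) (T : Chain G) : C.bottleneck m T ∈ H := by
  rcases C.bottleneck_eq m T with h' | h' | ⟨d, -, h'⟩ <;> rw [h']
  · exact H.sub_mem (hu _ _) (hm _ _)
  · exact H.sub_mem (hu _ _) (hm _ _)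
  · rw [h.residual_eq]; exact H.sub_mem (hp _ _ _) (hφ _)

/-- In Phase 1 the messages encode a flow, with values in any group that contains the
potentials. -/
theorem exists_isFlow_apmp (hC : C.IsCanonical) (hS : C.IsScheduler S) {H : AddSubgroup ℝ}
    (hu : ∀ i a, C.unary i a ∈ H) (hp : ∀ d a b, C.pair d a b ∈ H) {t : ℕ}
    (ht : (C.apmp S t).2 = false) :
    ∃ φ, C.IsFlow (C.apmp S t).1 φ ∧ (∀ d, φ d ∈ H) ∧ ∀ i a, (C.apmp S t).1.unary i a ∈ H := by
  induction t with
  | zero => exact ⟨_, isFlow_zero hC, fun _ => H.zero_mem, fun _ _ => H.zero_mem⟩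
  | succ t ih =>
    have ht' : (C.apmp S t).2 = false := by
      by_contra h
      rw [Bool.not_eq_false] at h
      rw [apmp_succ_of_true h] at ht
      cases ht
    obtain ⟨φ, h, hφ, hm⟩ := ih ht'
    rcases hT : S t (C.apmp S t).1 with _ | T
    · rw [apmp_succ_of_none ht' hT] at ht
      cases ht
    · have hA := (hS t _).1 T hT
      have hb := bottleneck_mem hu hp h hφ hm T
      rw [apmp_succ_of_some ht' hT]
      refine ⟨_, h.passChain hC hA, fun d => ?_, fun i a => ?_⟩
      · rw [augmentFlow]
        refine H.sub_mem (H.add_mem (hφ d) ?_) ?_ <;> split_ifs <;> simp [hb]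
      · rw [h.passChain_eq hC hA]
        refine H.add_mem (H.add_mem (hm i a) ?_) ?_ <;> split_ifs <;> simp [hb]

theorem exists_augmenting_of_not_terminates (hS : C.IsScheduler S) (h : ¬ C.Phase1Terminates S)
    (t : ℕ) : (C.apmp S t).2 = false ∧ ∃ T, S t (C.apmp S t).1 = some T ∧
      C.IsAugmenting (C.apmp S t).1 T ∧ (C.apmp S (t + 1)).1 = C.passChain (C.apmp S t).1 T := by
  have h' : ∀ t, (C.apmp S t).2 = false := fun t => by
    by_contra hc
    rw [Bool.not_eq_false] at hc
    exact h ⟨t, hc⟩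
  refine ⟨h' t, ?_⟩
  rcases hT : S t (C.apmp S t).1 with _ | T
  · have := h' (t + 1)
    rw [apmp_succ_of_none (h' t) hT] at this
    cases this
  · exact ⟨T, rfl, (hS t _).1 T hT, by rw [apmp_succ_of_some (h' t) hT]⟩

theorem phase1Terminates_of_isShortestPath (hC : C.IsCanonical) (hS : C.IsScheduler S)
    (hshort : C.IsShortestPath S) : C.Phase1Terminates S := by
  by_contra hcon
  apply not_strictAnti_of_wellFoundedLT fun t => C.progress (C.apmp S t).1
  apply strictAnti_nat_of_succ_lt
  intro t
  obtain ⟨ht, T, hT, hA, hnext⟩ := exists_augmenting_of_not_terminates hS hcon t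
  obtain ⟨φ, h, -, -⟩ := exists_isFlow_apmp (H := ⊤) hC hS (by simp) (by simp) ht
  rw [hnext]
  exact h.progress_passChain_lt hC hA (hshort t _ T hT)

theorem IsRational.exists_zmultiples (hC : C.IsRational) : ∃ δ : ℝ, 0 < δ ∧
    (∀ i a, C.unary i a ∈ AddSubgroup.zmultiples δ) ∧
      ∀ d a b, C.pair d a b ∈ AddSubgroup.zmultiples δ := by
  choose q hq using hC.1
  choose r hr using hC.2
  let g : (V × Bool) ⊕ (G.Dart × Bool × Bool) → ℚ :=
    Sum.elim (fun x => q x.1 x.2) (fun x => r x.1 x.2.1 x.2.2)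
  -- A common denominator of all potentials. It may be negative, hence the absolute value below.
  obtain ⟨b, hb⟩ := IsLocalization.exist_integer_multiples_of_finite (nonZeroDivisors ℤ) g
  have hb0 : ((b : ℤ) : ℝ) ≠ 0 := by
    exact_mod_cast nonZeroDivisors.ne_zero b.2
  have key : ∀ x, (g x : ℝ) ∈ AddSubgroup.zmultiples (|((b : ℤ) : ℝ)|⁻¹) := by
    intro x
    obtain ⟨n, hn⟩ := hb x
    have hn' : (n : ℝ) = (b : ℤ) * (g x : ℝ) := by
      have : (n : ℚ) = (b : ℤ) * g x := by
        simpa [Algebra.smul_def] using hn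
      exact_mod_cast this
    have : (g x : ℝ) = n * ((b : ℤ) : ℝ)⁻¹ := by rw [hn']; field_simp
    rw [this]
    rcases abs_choice ((b : ℤ) : ℝ) with h | h <;> rw [h]
    · exact ⟨n, by simp⟩
    · exact ⟨-n, by simp [inv_neg]⟩
  refine ⟨_, inv_pos.2 (abs_pos.2 hb0), fun i a => ?_, fun d a c => ?_⟩
  · rw [hq]; exact key (Sum.inl (i, a))
  · rw [hr]; exact key (Sum.inr (d, a, c))

/-- All bottlenecks are positive multiples of one `δ`. Each iteration thus adds at least `δ` to the
flow leaving the source, which is bounded by the total source capacity. -/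
theorem phase1Terminates_of_isRational (hC : C.IsCanonical) (hS : C.IsScheduler S)
    (hrat : C.IsRational) : C.Phase1Terminates S := by
  by_contra hcon
  obtain ⟨δ, hδ, hu, hp⟩ := hrat.exists_zmultiples
  have hgrow : ∀ t : ℕ, t * δ ≤ ∑ i, (C.apmp S t).1.unary i true := by
    intro t
    induction t with
    | zero => simp [apmp, zeroMessages]
    | succ t ih =>
      obtain ⟨ht, T, hT, hA, hnext⟩ := exists_augmenting_of_not_terminates hS hcon t
      obtain ⟨φ, h, hφ, hm⟩ := exists_isFlow_apmp hC hS hu hp ht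
      obtain ⟨n, hn⟩ := bottleneck_mem hu hp h hφ hm T
      have hf : 0 < C.bottleneck (C.apmp S t).1 T := hA
      have hle : δ ≤ C.bottleneck (C.apmp S t).1 T := by
        rw [← hn] at hf ⊢
        simp only [zsmul_eq_mul] at hf ⊢
        have hn0 : (0 : ℝ) < n := pos_of_mul_pos_left hf hδ.le
        have : (1 : ℝ) ≤ n := by exact_mod_cast hn0
        nlinarith
      rw [hnext, h.passChain_eq hC hA]
      simp only [Finset.sum_add_distrib]
      simp
      linarith
  obtain ⟨t, ht⟩ := exists_nat_gt ((∑ i, C.unary i true) / δ)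
  rw [div_lt_iff₀ hδ] at ht
  obtain ⟨hflag, -⟩ := exists_augmenting_of_not_terminates hS hcon t
  obtain ⟨φ, h, -⟩ := exists_isFlow_apmp hC hS hu hp hflag
  have h1 := hgrow t
  have h2 : ∑ i, (C.apmp S t).1.unary i true ≤ ∑ i, C.unary i true :=
    Finset.sum_le_sum fun i _ => h.unary_le i true
  linarith

end PairwiseEnergy

/-- A positive generator `a` can occur at most `B / a` times in a sum of nonnegative terms bounded
by `B`. This discreteness turns monotone convergence of Phase 2 into finite termination. -/
theorem AddSubmonoid.finite_closure_inter_Iic {s : Set ℝ} (hs : s.Finite) (h0 : ∀ a ∈ s, 0 ≤ a)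
    (B : ℝ) : {x | x ∈ AddSubmonoid.closure s ∧ x ≤ B}.Finite := by
  induction s, hs using Set.Finite.induction_on with
  | empty =>
    apply (Set.finite_singleton (0 : ℝ)).subset
    rintro x ⟨hx, -⟩
    simpa using hx
  | @insert a s ha hs ih =>
    have ih := ih fun b hb => h0 b (Set.mem_insert_of_mem _ hb)
    have ha0 : 0 ≤ a := h0 a (Set.mem_insert _ _)
    obtain ⟨N, hN⟩ := exists_nat_gt (B / a)
    apply ((Set.finite_Iic N).image2 (fun n y => n • a + y) ih).subset
    rintro x ⟨hx, hxB⟩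
    rw [Set.insert_eq, AddSubmonoid.closure_union, AddSubmonoid.mem_sup] at hx
    obtain ⟨z, hz, y, hy, rfl⟩ := hx
    obtain ⟨n, rfl⟩ := AddSubmonoid.mem_closure_singleton.1 hz
    have hna : 0 ≤ n • a := nsmul_nonneg ha0 n
    have hy0 : 0 ≤ y := (AddSubmonoid.closure_le (S := AddSubmonoid.nonneg ℝ)).2
      (fun b hb => h0 b (Set.mem_insert_of_mem _ hb)) hy
    -- A zero generator has unbounded multiplicity but contributes nothing, so multiplicity `0`
    -- represents it.
    rcases ha0.eq_or_lt with rfl | hapos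
    · exact ⟨0, by simp, y, ⟨hy, by simpa using hxB⟩, by simp⟩
    · refine ⟨n, ?_, y, ⟨hy, by linarith⟩, rfl⟩
      rw [Set.mem_Iic]
      have h1 : n • a ≤ B := by linarith
      rw [nsmul_eq_mul, ← le_div_iff₀ hapos] at h1
      exact_mod_cast (h1.trans_lt hN).le

namespace PairwiseEnergy

variable {V : Type*} [Fintype V] [DecidableEq V] {G : SimpleGraph V} [DecidableRel G.Adj]

/-! ### A monotone form of Strict MP -/

/-- One parallel update of the magnitudes `Q` of the messages to factors and `P` of the messages to
variables, when all messages into a variable have the same sign: `ρ` is the evidence at the variables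
and `R` bounds the messages to variables. -/
noncomputable def magnitudeStep (ρ : V → ℝ) (R : G.Dart → ℝ)
    (x : (G.Dart → ℝ) × (G.Dart → ℝ)) : (G.Dart → ℝ) × (G.Dart → ℝ) :=
  (fun d => ρ d.fst + ∑ e : G.Dart with e.snd = d.fst ∧ e ≠ d.symm, x.2 e,
    fun d => min (x.1 d) (R d))

theorem magnitudeStep_mono (ρ : V → ℝ) (R : G.Dart → ℝ) : Monotone (magnitudeStep (G := G) ρ R) := by
  rintro x y ⟨h1, h2⟩
  refine ⟨fun d => ?_, fun d => min_le_min_right _ (h1 d)⟩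
  exact add_le_add_right (Finset.sum_le_sum fun e _ => h2 e) _

theorem magnitudeStep_iterate_bounds {ρ : V → ℝ} {R : G.Dart → ℝ} (hρ : ∀ i, 0 ≤ ρ i)
    (hR : ∀ d, 0 ≤ R d) (n : ℕ) (d : G.Dart) :
    0 ≤ ((magnitudeStep ρ R)^[n] (0, 0)).1 d ∧ 0 ≤ ((magnitudeStep ρ R)^[n] (0, 0)).2 d ∧
      ((magnitudeStep ρ R)^[n] (0, 0)).2 d ≤ R d := by
  induction n generalizing d with
  | zero => exact ⟨le_rfl, le_rfl, hR d⟩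
  | succ n ih =>
    rw [Function.iterate_succ_apply']
    exact ⟨add_nonneg (hρ _) (Finset.sum_nonneg fun e _ => (ih e).2.1),
      le_min (ih d).1 (hR d), min_le_right _ _⟩

/-- The iterates increase from `0`. Their second components are bounded by `R` and lie in the
submonoid generated by the values of `ρ` and `R`, so they take finitely many values and become
constant. -/
theorem exists_magnitudeStep_iterate_isFixedPt {ρ : V → ℝ} {R : G.Dart → ℝ} (hρ : ∀ i, 0 ≤ ρ i)
    (hR : ∀ d, 0 ≤ R d) :
    ∃ N, magnitudeStep ρ R ((magnitudeStep ρ R)^[N] (0, 0)) = (magnitudeStep ρ R)^[N] (0, 0) := by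
  set F := magnitudeStep (G := G) ρ R with hF
  have hmono : Monotone fun n => F^[n] (0, 0) :=
    (magnitudeStep_mono ρ R).monotone_iterate_of_le_map
      ⟨fun d => (magnitudeStep_iterate_bounds hρ hR 1 d).1,
        fun d => (magnitudeStep_iterate_bounds hρ hR 1 d).2.1⟩
  set M := AddSubmonoid.closure (Set.range ρ ∪ Set.range R) with hM
  have hmem : ∀ n d, (F^[n] (0, 0)).1 d ∈ M ∧ (F^[n] (0, 0)).2 d ∈ M := by
    intro n
    induction n with
    | zero => exact fun d => ⟨M.zero_mem, M.zero_mem⟩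
    | succ n ih =>
      intro d
      rw [Function.iterate_succ_apply']
      refine ⟨M.add_mem (AddSubmonoid.subset_closure (Or.inl ⟨_, rfl⟩))
        (M.sum_mem fun e _ => (ih e).2), ?_⟩
      show min _ _ ∈ M
      rcases min_choice ((F^[n] (0, 0)).1 d) (R d) with h | h <;> rw [h]
      · exact (ih d).1
      · exact AddSubmonoid.subset_closure (Or.inr ⟨_, rfl⟩)
  have hfin : (Set.univ.pi fun d : G.Dart => {x | x ∈ M ∧ x ≤ R d}).Finite := by
    apply Set.Finite.pi
    intro d
    apply AddSubmonoid.finite_closure_inter_Iic ((Set.finite_range _).union (Set.finite_range _))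
    rintro a (⟨i, rfl⟩ | ⟨d, rfl⟩)
    · exact hρ i
    · exact hR d
  have := hfin.to_subtype
  obtain ⟨N, hN⟩ := WellFoundedGT.monotone_chain_condition
    (⟨fun n => ⟨(F^[n] (0, 0)).2, fun d _ =>
        ⟨(hmem n d).2, (magnitudeStep_iterate_bounds hρ hR n d).2.2⟩⟩,
      fun a b hab => (hmono hab).2⟩ :
      ℕ →o (Set.univ.pi fun d : G.Dart => {x | x ∈ M ∧ x ≤ R d}))
  have hN' : ∀ n, N ≤ n → (F^[N] (0, 0)).2 = (F^[n] (0, 0)).2 := fun n hn =>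
    congrArg Subtype.val (hN n hn)
  have hcongr : ∀ x y : (G.Dart → ℝ) × (G.Dart → ℝ), x.2 = y.2 → (F x).1 = (F y).1 := by
    intro x y hxy
    simp only [hF, magnitudeStep, hxy]
  -- The first component is a function of the previous second component, so it settles one step
  -- later.
  refine ⟨N + 1, Prod.ext ?_ ?_⟩
  · conv_rhs => rw [Function.iterate_succ_apply']
    exact hcongr _ _ (hN' (N + 1) N.le_succ).symm
  · rw [← Function.iterate_succ_apply' F, ← hN' _ N.le_succ, ← hN' (N + 1 + 1) (by omega)]

/-! ### The two sides of a flow without augmenting path -/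

variable {C : PairwiseEnergy G} {m : Messages G} {φ : G.Dart → ℝ}

/-- `i` can be reached from the source in the residual graph. -/
def OnSourceSide (C : PairwiseEnergy G) (m : Messages G) (i : V) : Prop := ∃ k, i ∈ C.reach m k

/-- The sink can be reached from `i` in the residual graph. -/
def OnSinkSide (C : PairwiseEnergy G) (m : Messages G) (i : V) : Prop :=
  ∃ (w : V) (p : G.Walk i w), 0 < C.residualSink m w ∧ ∀ d ∈ p.darts, 0 < C.residual m d

theorem OnSourceSide.snd {d : G.Dart} (h : C.OnSourceSide m d.fst) (hd : 0 < C.residual m d) :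
    C.OnSourceSide m d.snd := by
  obtain ⟨k, hk⟩ := h
  exact ⟨k + 1, Or.inr ⟨d, hd, rfl, hk⟩⟩

theorem OnSinkSide.fst {d : G.Dart} (h : C.OnSinkSide m d.snd) (hd : 0 < C.residual m d) :
    C.OnSinkSide m d.fst := by
  obtain ⟨w, p, hw, hp⟩ := h
  refine ⟨w, .cons d.adj p, hw, fun e he => ?_⟩
  rw [SimpleGraph.Walk.darts_cons, List.mem_cons] at he
  rcases he with rfl | he
  · exact hd
  · exact hp e he

theorem not_onSourceSide_of_onSinkSide (hno : ∀ T, ¬ C.IsAugmenting m T) {i : V}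
    (h : C.OnSinkSide m i) : ¬ C.OnSourceSide m i := by
  rintro ⟨k, hk⟩
  obtain ⟨w, q, hw, hq⟩ := h
  obtain ⟨u, p, hu, hp, -⟩ := exists_walk_of_mem_reach hk
  obtain ⟨T, hT, -⟩ := exists_isAugmenting (p.append q) hu hw (fun e he => by
    rw [SimpleGraph.Walk.darts_append, List.mem_append] at he
    exact he.elim (hp e) (hq e))
  exact hno T hT

open Classical in
/-- `1` on the source side, `-1` on the sink side, and `0` elsewhere. -/
noncomputable def side (C : PairwiseEnergy G) (m : Messages G) (i : V) : ℝ :=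
  if C.OnSourceSide m i then 1 else if C.OnSinkSide m i then -1 else 0

open Classical in
/-- The residual capacity of a dart in the direction in which evidence is passed along it. -/
noncomputable def slack (C : PairwiseEnergy G) (m : Messages G) (d : G.Dart) : ℝ :=
  if C.OnSourceSide m d.fst then C.residual m d else
    if C.OnSinkSide m d.fst then C.residual m d.symm else 0

/-- The evidence at a variable which the flow does not use. -/
noncomputable def surplus (C : PairwiseEnergy G) (m : Messages G) (i : V) : ℝ :=
  C.residualSource m i - C.residualSink m i

theorem side_of_onSourceSide {i : V} (h : C.OnSourceSide m i) : C.side m i = 1 := by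
  rw [side, if_pos h]

theorem side_of_onSinkSide (hno : ∀ T, ¬ C.IsAugmenting m T) {i : V} (h : C.OnSinkSide m i) :
    C.side m i = -1 := by
  rw [side, if_neg (not_onSourceSide_of_onSinkSide hno h), if_pos h]

theorem IsFlow.slack_nonneg (h : C.IsFlow m φ) (d : G.Dart) : 0 ≤ C.slack m d := by
  rw [slack]
  split_ifs
  · exact h.residual_nonneg _
  · exact h.residual_nonneg _
  · exact le_rfl

/-- The source side is closed under following residual darts, the sink side under following them
backward, and these are the directions in which the slack is measured. Hence evidence never crosses
between sides. -/
theorem side_fst_eq_side_snd (hno : ∀ T, ¬ C.IsAugmenting m T) {d : G.Dart}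
    (hd : 0 < C.slack m d) : C.side m d.fst = C.side m d.snd := by
  rw [slack] at hd
  split_ifs at hd with h1 h2
  · rw [side_of_onSourceSide h1, side_of_onSourceSide (h1.snd hd)]
  · have h3 : C.OnSinkSide m d.snd := OnSinkSide.fst (d := d.symm) h2 hd
    rw [side_of_onSinkSide hno h2, side_of_onSinkSide hno h3]
  · exact absurd hd (lt_irrefl _)

theorem side_fst_mul_eq (hno : ∀ T, ¬ C.IsAugmenting m T) {d : G.Dart} {x : ℝ} (hx : 0 ≤ x)
    (hxd : x ≤ C.slack m d) : C.side m d.fst * x = C.side m d.snd * x := by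
  rcases hx.eq_or_lt with rfl | hx
  · simp
  · rw [side_fst_eq_side_snd hno (hx.trans_le hxd)]

theorem IsFlow.residualSource_nonneg (h : C.IsFlow m φ) (i : V) : 0 ≤ C.residualSource m i :=
  sub_nonneg.2 (h.unary_le i true)

theorem IsFlow.residualSink_nonneg (h : C.IsFlow m φ) (i : V) : 0 ≤ C.residualSink m i :=
  sub_nonneg.2 (h.unary_le i false)

theorem IsFlow.residualSource_eq_zero_or (hC : C.IsCanonical) (h : C.IsFlow m φ) (i : V) :
    C.residualSource m i = 0 ∨ C.residualSink m i = 0 := by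
  rcases (hC.2 i).2.2 with h0 | h0
  · exact Or.inr (le_antisymm (by
      rw [residualSink]; linarith [h.unary_nonneg i false]) (h.residualSink_nonneg i))
  · exact Or.inl (le_antisymm (by
      rw [residualSource]; linarith [h.unary_nonneg i true]) (h.residualSource_nonneg i))

theorem onSourceSide_of_residualSource {i : V} (h : 0 < C.residualSource m i) :
    C.OnSourceSide m i := ⟨0, h⟩

theorem onSinkSide_of_residualSink {i : V} (h : 0 < C.residualSink m i) :
    C.OnSinkSide m i := ⟨i, .nil, h, by simp⟩

/-- Unused evidence agrees in sign with its vertex: leftover source capacity puts the vertex on the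
source side, leftover sink capacity on the sink side. -/
theorem IsFlow.surplus_eq (hC : C.IsCanonical) (h : C.IsFlow m φ)
    (hno : ∀ T, ¬ C.IsAugmenting m T) (i : V) :
    C.surplus m i = C.side m i * |C.surplus m i| := by
  have h1 := h.residualSource_nonneg i
  have h2 := h.residualSink_nonneg i
  rw [surplus]
  rcases h.residualSource_eq_zero_or hC i with h0 | h0
  · rw [h0, zero_sub, abs_neg, abs_of_nonneg h2]
    rcases h2.eq_or_lt with h3 | h3
    · rw [← h3]; simp
    · rw [side_of_onSinkSide hno (onSinkSide_of_residualSink h3)]; ring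
  · rw [h0, sub_zero, abs_of_nonneg h1]
    rcases h1.eq_or_lt with h3 | h3
    · rw [← h3]; simp
    · rw [side_of_onSourceSide (onSourceSide_of_residualSource h3)]; ring

/-- The shift goes in one direction only, and the slack is the room left there before the
truncation. The opposite bound cannot be hit because the flow is feasible. -/
theorem IsFlow.clamp_eq (h : C.IsFlow m φ) (d : G.Dart) {x : ℝ}
    (hx : 0 ≤ x) :
    max (-C.pair d.symm false true) (min (φ d + C.side m d.fst * x) (C.pair d false true)) =
      φ d + C.side m d.fst * min x (C.slack m d) := by
  have h1 := h.le_cap d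
  have h2 := h.le_cap d.symm
  rw [h.symm] at h2
  rw [side, slack]
  split_ifs with h3 h4
  · rw [h.residual_eq, one_mul, one_mul, max_eq_right (le_min (by linarith) (by linarith)),
      ← min_add_add_left]
    congr 1; ring
  · rw [h.residual_eq, h.symm, min_eq_left (by linarith)]
    rcases le_total x (C.pair d.symm false true - -φ d) with h5 | h5
    · rw [min_eq_left h5, max_eq_right (by linarith)]
    · rw [min_eq_right h5, max_eq_left (by linarith)]; ring
  · rw [zero_mul, zero_mul, add_zero, min_eq_left h1, max_eq_right (by linarith)]

/-- The messages of Phase 2: those of the flow, shifted by the magnitudes `x` towards the label of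
the side. -/
noncomputable def phase2Messages (C : PairwiseEnergy G) (m : Messages G) (φ : G.Dart → ℝ)
    (x : (G.Dart → ℝ) × (G.Dart → ℝ)) : Messages G where
  unary := C.unary
  toFactor d := ofDiff (φ d + C.side m d.fst * x.1 d)
  toVar d := ofDiff (φ d + C.side m d.fst * x.2 d)

theorem IsCanonical.unaryUpdate_eq (hC : C.IsCanonical) : C.unaryUpdate = C.unary := by
  funext i
  rw [unaryUpdate, normalizeMsg_eq_ofDiff, ofDiff_eq_self (hC.2 i).1 (hC.2 i).2.1 (hC.2 i).2.2]

/-- Flow messages are already stable under the variable and factor updates; the first step of Phase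
2 only releases the full unary potentials. -/
theorem IsFlow.strictMP_eq (hC : C.IsCanonical) (h : C.IsFlow m φ) :
    C.strictMP m = C.phase2Messages m φ (0, 0) := by
  refine Messages.ext hC.unaryUpdate_eq ?_ ?_
  · funext d
    show C.toFactorUpdate m d = ofDiff (φ d + C.side m d.fst * 0)
    rw [toFactorUpdate_eq, h.excess_eq, h.toVar_eq, ofDiff_sub, h.symm]
    congr 1; ring
  · funext d
    show C.toVarUpdate m d = ofDiff (φ d + C.side m d.fst * 0)
    have h1 := h.clamp_eq d le_rfl
    rw [min_eq_left (h.slack_nonneg d), mul_zero, add_zero] at h1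
    rw [toVarUpdate_eq hC (h.toFactor_eq d), h1, mul_zero, add_zero]

/-- Conservation cancels the flow and leaves the surplus plus the incoming shifts. All of these have
the sign of the side of `i`, since a dart between different sides carries no shift. -/
theorem IsFlow.excess_phase2Messages (hC : C.IsCanonical) (h : C.IsFlow m φ)
    (hno : ∀ T, ¬ C.IsAugmenting m T) {x : (G.Dart → ℝ) × (G.Dart → ℝ)}
    (hx : ∀ d, 0 ≤ x.2 d ∧ x.2 d ≤ C.slack m d) (i : V) :
    (C.phase2Messages m φ x).excess i =
      C.side m i * (|C.surplus m i| + ∑ e : G.Dart with e.snd = i, x.2 e) := by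
  rw [Messages.excess, mul_add, ← h.surplus_eq hC hno]
  simp only [phase2Messages, ofDiff_sub, Finset.sum_add_distrib]
  have h1 : ∑ e : G.Dart with e.snd = i, C.side m e.fst * x.2 e =
      C.side m i * ∑ e : G.Dart with e.snd = i, x.2 e := by
    rw [Finset.mul_sum]
    apply Finset.sum_congr rfl
    intro e he
    rw [side_fst_mul_eq hno (hx e).1 (hx e).2, (Finset.mem_filter.1 he).2]
  have h2 := h.conserve i
  rw [h1, surplus, residualSource, residualSink]
  linarith

theorem IsFlow.strictMP_phase2Messages (hC : C.IsCanonical) (h : C.IsFlow m φ)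
    (hno : ∀ T, ¬ C.IsAugmenting m T) {x : (G.Dart → ℝ) × (G.Dart → ℝ)}
    (hx : ∀ d, 0 ≤ x.1 d ∧ 0 ≤ x.2 d ∧ x.2 d ≤ C.slack m d) :
    C.strictMP (C.phase2Messages m φ x) =
      C.phase2Messages m φ (magnitudeStep (fun i => |C.surplus m i|) (C.slack m) x) := by
  refine Messages.ext hC.unaryUpdate_eq ?_ ?_
  · funext d
    show C.toFactorUpdate _ d = ofDiff (φ d + C.side m d.fst *
      (|C.surplus m d.fst| + ∑ e : G.Dart with e.snd = d.fst ∧ e ≠ d.symm, x.2 e))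
    rw [toFactorUpdate_eq, h.excess_phase2Messages hC hno fun d => (hx d).2,
      Messages.sum_snd_eq_add d rfl]
    have h1 := side_fst_mul_eq hno (hx d.symm).2.1 (hx d.symm).2.2
    simp only [phase2Messages, ofDiff_sub, h.symm, h1]
    congr 1
    show _ - (_ + C.side m d.fst * _) = _
    ring
  · funext d
    show C.toVarUpdate _ d = ofDiff (φ d + C.side m d.fst * min (x.1 d) (C.slack m d))
    rw [toVarUpdate_eq hC (z := φ d + C.side m d.fst * x.1 d) rfl, h.clamp_eq d (hx d).1]

theorem IsFlow.strictMP_iterate (hC : C.IsCanonical) (h : C.IsFlow m φ)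
    (hno : ∀ T, ¬ C.IsAugmenting m T) (n : ℕ) :
    C.strictMP^[n + 1] m = C.phase2Messages m φ
      ((magnitudeStep (fun i => |C.surplus m i|) (C.slack m))^[n] (0, 0)) := by
  induction n with
  | zero => exact h.strictMP_eq hC
  | succ n ih =>
    rw [Function.iterate_succ_apply', ih, h.strictMP_phase2Messages hC hno, ←
      Function.iterate_succ_apply' (magnitudeStep _ _)]
    exact fun d => magnitudeStep_iterate_bounds (fun i => abs_nonneg _) h.slack_nonneg n d

end PairwiseEnergy

namespace PairwiseEnergy

variable {V : Type*} [Fintype V] [DecidableEq V] {G : SimpleGraph V} [DecidableRel G.Adj]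
variable {C : PairwiseEnergy G} {m : Messages G} {φ : G.Dart → ℝ}

theorem belief_sub (E : PairwiseEnergy G) (m : Messages G) (i : V) :
    E.belief m i true - E.belief m i false = E.unary i true - E.unary i false +
      ∑ e : G.Dart with e.snd = i, (m.toVar e true - m.toVar e false) := by
  rw [belief, belief, Finset.sum_sub_distrib]; ring

/-! ### Beliefs at the fixed point of Phase 2 -/

section Beliefs

variable {x : (G.Dart → ℝ) × (G.Dart → ℝ)}

/-- The magnitude of the belief at `x_i`. -/
noncomputable def beliefMagnitude (C : PairwiseEnergy G) (m : Messages G) (P : G.Dart → ℝ) (i : V) :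
    ℝ :=
  |C.surplus m i| + ∑ e : G.Dart with e.snd = i, P e

/-- The belief at the tail is `x.1 d + x.2 d.symm`. If the first term is positive, it passes through
the positive slack to the head. Otherwise the second is positive, and it came from evidence already
present at the head. -/
theorem beliefMagnitude_snd_pos
    (hx : ∀ d, 0 ≤ x.1 d ∧ 0 ≤ x.2 d ∧ x.2 d ≤ C.slack m d)
    (hfix : magnitudeStep (fun i => |C.surplus m i|) (C.slack m) x = x) {d : G.Dart}
    (hd : 0 < C.slack m d) (hb : 0 < C.beliefMagnitude m x.2 d.fst) :
    0 < C.beliefMagnitude m x.2 d.snd := by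
  have hQ : ∀ d, x.1 d = |C.surplus m d.fst| +
      ∑ e : G.Dart with e.snd = d.fst ∧ e ≠ d.symm, x.2 e := fun d =>
    (congrFun (congrArg Prod.fst hfix) d).symm
  have hP : ∀ d, x.2 d = min (x.1 d) (C.slack m d) := fun d =>
    (congrFun (congrArg Prod.snd hfix) d).symm
  have hB : ∀ d : G.Dart, C.beliefMagnitude m x.2 d.fst = x.1 d + x.2 d.symm := fun d => by
    rw [beliefMagnitude, Messages.sum_snd_eq_add d rfl, hQ]; ring
  have hB' := hB d.symm
  rw [SimpleGraph.Dart.symm_symm] at hB'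
  change C.beliefMagnitude m x.2 d.snd = _ at hB'
  rw [hB] at hb
  rw [hB']
  have h1 := (hx d.symm).1
  have h2 := (hx d).2.1
  rcases (hx d).1.eq_or_lt with h0 | h0
  · have h3 : 0 < x.2 d.symm := by linarith
    have h4 : x.2 d.symm ≤ x.1 d.symm := by rw [hP]; exact min_le_left _ _
    linarith
  · have h3 : 0 < x.2 d := by rw [hP]; exact lt_min h0 hd
    linarith

theorem beliefMagnitude_pos_of_surplus (hx : ∀ d, 0 ≤ x.2 d) {i : V} (h : C.surplus m i ≠ 0) :
    0 < C.beliefMagnitude m x.2 i :=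
  add_pos_of_pos_of_nonneg (abs_pos.2 h) (Finset.sum_nonneg fun e _ => hx e)

theorem IsFlow.beliefMagnitude_pos_of_onSourceSide (hC : C.IsCanonical) (h : C.IsFlow m φ)
    (hx : ∀ d, 0 ≤ x.1 d ∧ 0 ≤ x.2 d ∧ x.2 d ≤ C.slack m d)
    (hfix : magnitudeStep (fun i => |C.surplus m i|) (C.slack m) x = x) {i : V}
    (hi : C.OnSourceSide m i) : 0 < C.beliefMagnitude m x.2 i := by
  obtain ⟨k, hk⟩ := hi
  induction k generalizing i with
  | zero =>
    change 0 < C.residualSource m i at hk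
    apply beliefMagnitude_pos_of_surplus fun d => (hx d).2.1
    rw [surplus, (h.residualSource_eq_zero_or hC i).resolve_left hk.ne', sub_zero]
    exact hk.ne'
  | succ k ih =>
    rcases hk with hk | ⟨d, hd, rfl, hk⟩
    · exact ih hk
    · refine beliefMagnitude_snd_pos hx hfix ?_ (ih hk)
      rw [slack, if_pos ⟨k, hk⟩]
      exact hd

theorem IsFlow.beliefMagnitude_pos_of_onSinkSide (hC : C.IsCanonical) (h : C.IsFlow m φ)
    (hno : ∀ T, ¬ C.IsAugmenting m T)
    (hx : ∀ d, 0 ≤ x.1 d ∧ 0 ≤ x.2 d ∧ x.2 d ≤ C.slack m d)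
    (hfix : magnitudeStep (fun i => |C.surplus m i|) (C.slack m) x = x) {i : V}
    (hi : C.OnSinkSide m i) : 0 < C.beliefMagnitude m x.2 i := by
  obtain ⟨w, p, hw, hp⟩ := hi
  induction p with
  | @nil i =>
    apply beliefMagnitude_pos_of_surplus fun d => (hx d).2.1
    rw [surplus, (h.residualSource_eq_zero_or hC i).resolve_right hw.ne', zero_sub]
    exact neg_ne_zero.2 hw.ne'
  | @cons u v w a p ih =>
    have htail : ∀ e ∈ p.darts, 0 < C.residual m e := fun e he => hp e (by simp [he])
    have hv : C.OnSinkSide m v := ⟨w, p, hw, htail⟩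
    -- Evidence from the sink travels against the residual walk, so the reversed dart is used.
    refine beliefMagnitude_snd_pos hx hfix (d := ⟨(v, u), a.symm⟩) ?_ (ih hw htail)
    rw [slack, if_neg (not_onSourceSide_of_onSinkSide hno hv), if_pos hv]
    exact hp _ (by simp [SimpleGraph.Dart.symm])

theorem IsFlow.belief_phase2Messages (hC : C.IsCanonical) (h : C.IsFlow m φ)
    (hno : ∀ T, ¬ C.IsAugmenting m T) (hx : ∀ d, 0 ≤ x.2 d ∧ x.2 d ≤ C.slack m d) (i : V) :
    C.belief (C.phase2Messages m φ x) i true - C.belief (C.phase2Messages m φ x) i false =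
      C.side m i * C.beliefMagnitude m x.2 i := by
  rw [belief_sub, beliefMagnitude, ← h.excess_phase2Messages hC hno hx]
  rfl

end Beliefs

/-! ### Optimality -/

theorem sum_dart_symm (g : G.Dart → ℝ) : ∑ d : G.Dart, g d.symm = ∑ d, g d :=
  Equiv.sum_comp (Function.Involutive.toPerm _ SimpleGraph.Dart.symm_involutive) g

theorem sum_dart_snd (g : G.Dart → ℝ) (x : V → Bool) :
    ∑ d : G.Dart, (if x d.snd = true then g d else 0) =
      ∑ i, if x i = true then ∑ e : G.Dart with e.snd = i, g e else 0 := by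
  rw [← Finset.sum_fiberwise Finset.univ (fun d : G.Dart => d.snd)]
  apply Finset.sum_congr rfl
  intro i _
  rw [Finset.sum_congr rfl fun d hd => by rw [(Finset.mem_filter.1 hd).2]]
  split_ifs <;> simp

/-- The energy is a constant (the value of the flow) plus the residual capacity of the cut that
corresponds to the assignment. -/
theorem IsFlow.energy_eq (hC : C.IsCanonical) (h : C.IsFlow m φ) (x : V → Bool) :
    C.energy x = ∑ i, m.unary i false +
      ∑ i, (if x i = true then C.residualSource m i else C.residualSink m i) +
      ∑ d : G.Dart, (if x d.fst = false ∧ x d.snd = true then C.residual m d else 0) := by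
  -- Each potential splits into the cut costs of the dart and of its reverse; summed over darts,
  -- this doubling absorbs the factor `1 / 2`.
  have hpair : ∀ d, C.pair d (x d.fst) (x d.snd) =
      (if x d.fst = false ∧ x d.snd = true then C.pair d false true else 0) +
      (if x d.symm.fst = false ∧ x d.symm.snd = true then C.pair d.symm false true else 0) := by
    intro d
    obtain ⟨h00, h11, -, -⟩ := hC.1 d
    have h10 := C.pair_true_false d
    show _ = _ + (if x d.snd = false ∧ x d.fst = true then C.pair d.symm false true else 0)
    cases hf : x d.fst <;> cases hs : x d.snd <;> simp [h00, h11, h10]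
  -- Flow between vertices labelled `1` cancels by antisymmetry, so the flow across the cut is the
  -- sum of their net inflows, which conservation evaluates.
  have hflow : ∑ d : G.Dart, (if x d.fst = false ∧ x d.snd = true then φ d else 0) =
      -∑ i, (if x i = true then m.unary i true - m.unary i false else 0) := by
    have h1 : ∑ d : G.Dart, (if x d.fst = true ∧ x d.snd = true then φ d else 0) = 0 := by
      have h2 := sum_dart_symm
        (fun d : G.Dart => if x d.fst = true ∧ x d.snd = true then φ d else 0)
      have h3 : ∀ d : G.Dart,
          (if x d.symm.fst = true ∧ x d.symm.snd = true then φ d.symm else 0) =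
          -(if x d.fst = true ∧ x d.snd = true then φ d else 0) := by
        intro d
        show (if x d.snd = true ∧ x d.fst = true then φ d.symm else 0) = _
        rw [h.symm]
        cases x d.fst <;> cases x d.snd <;> simp
      simp only [h3, Finset.sum_neg_distrib] at h2
      linarith
    have h4 := sum_dart_snd φ x
    have h5 : ∀ d : G.Dart, (if x d.snd = true then φ d else 0) =
        (if x d.fst = false ∧ x d.snd = true then φ d else 0) +
        (if x d.fst = true ∧ x d.snd = true then φ d else 0) := by
      intro d
      cases x d.fst <;> simp
    simp only [h5, Finset.sum_add_distrib, h1, add_zero] at h4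
    rw [h4, ← Finset.sum_neg_distrib]
    apply Finset.sum_congr rfl
    intro i _
    have := h.conserve i
    split_ifs
    · linarith
    · simp
  have hres : ∑ d : G.Dart, (if x d.fst = false ∧ x d.snd = true then C.pair d false true else 0) =
      ∑ d : G.Dart, (if x d.fst = false ∧ x d.snd = true then C.residual m d else 0) +
      ∑ d : G.Dart, (if x d.fst = false ∧ x d.snd = true then φ d else 0) := by
    rw [← Finset.sum_add_distrib]
    apply Finset.sum_congr rfl
    intro d _
    rw [h.residual_eq]
    split_ifs <;> simp
  have hunary : ∑ i, C.unary i (x i) = ∑ i, m.unary i false +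
      ∑ i, (if x i = true then C.residualSource m i else C.residualSink m i) +
      ∑ i, (if x i = true then m.unary i true - m.unary i false else 0) := by
    rw [← Finset.sum_add_distrib, ← Finset.sum_add_distrib]
    apply Finset.sum_congr rfl
    intro i _
    cases x i <;> simp [residualSource, residualSink]
    ring
  rw [energy]
  simp only [hpair, Finset.sum_add_distrib]
  rw [sum_dart_symm (fun d : G.Dart =>
    if x d.fst = false ∧ x d.snd = true then C.pair d false true else 0), hres, hflow, hunary]
  ring

theorem IsFlow.isMinimizer (hC : C.IsCanonical) (h : C.IsFlow m φ) {x : V → Bool}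
    (hu : ∀ i, (if x i = true then C.residualSource m i else C.residualSink m i) = 0)
    (hp : ∀ d : G.Dart, x d.fst = false → x d.snd = true → C.residual m d = 0) :
    C.IsMinimizer x := by
  intro y
  rw [h.energy_eq hC x, h.energy_eq hC y]
  have h1 : ∑ i, (if x i = true then C.residualSource m i else C.residualSink m i) = 0 :=
    Finset.sum_eq_zero fun i _ => hu i
  have h2 : ∑ d : G.Dart,
      (if x d.fst = false ∧ x d.snd = true then C.residual m d else 0) = 0 :=
    Finset.sum_eq_zero fun d _ => by
      split_ifs with hd
      · exact hp d hd.1 hd.2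
      · rfl
  have h3 : 0 ≤ ∑ i, (if y i = true then C.residualSource m i else C.residualSink m i) :=
    Finset.sum_nonneg fun i _ => by
      split_ifs
      · exact h.residualSource_nonneg i
      · exact h.residualSink_nonneg i
  have h4 : 0 ≤ ∑ d : G.Dart,
      (if y d.fst = false ∧ y d.snd = true then C.residual m d else 0) :=
    Finset.sum_nonneg fun d _ => by
      split_ifs
      · exact h.residual_nonneg d
      · exact le_rfl
  linarith

theorem exists_isDecoding (E : PairwiseEnergy G) (m : Messages G) : ∃ x, E.IsDecoding m x := by
  classical
  refine ⟨fun i => decide (E.belief m i true < E.belief m i false), fun i a => ?_,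
    fun d h1 h2 _ => by simp [h1, h2]⟩
  by_cases h : E.belief m i true < E.belief m i false
  · cases a <;> simp [h, h.le]
  · have h' := not_lt.1 h
    cases a <;> simp [h, h']

/-- Strict MP, started from the messages of a flow without augmenting path, becomes stationary at an
optimal fixed point. -/
theorem IsFlow.exists_strictMP_isOptimalFixedPoint (hC : C.IsCanonical) (h : C.IsFlow m φ)
    (hno : ∀ T, ¬ C.IsAugmenting m T) :
    ∃ N, C.IsOptimalFixedPoint (C.strictMP^[N] m) := by
  obtain ⟨N, hN⟩ := exists_magnitudeStep_iterate_isFixedPt (G := G)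
    (fun i => abs_nonneg (C.surplus m i)) h.slack_nonneg
  have hx := magnitudeStep_iterate_bounds (fun i => abs_nonneg (C.surplus m i)) h.slack_nonneg N
  refine ⟨N + 1, ?_⟩
  rw [h.strictMP_iterate hC hno N]
  set x := (magnitudeStep (fun i => |C.surplus m i|) (C.slack m))^[N] (0, 0) with hxdef
  refine ⟨?_, exists_isDecoding _ _, fun y hy => ?_⟩
  · rw [IsMPFixedPoint, h.strictMP_phase2Messages hC hno hx, hN]
  have hbel := h.belief_phase2Messages hC hno fun d => (hx d).2
  have hsource : ∀ i, C.OnSourceSide m i → y i = false := by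
    intro i hi
    have h1 := hbel i
    have h2 := h.beliefMagnitude_pos_of_onSourceSide hC hx hN hi
    rw [side_of_onSourceSide hi, one_mul] at h1
    have h3 := hy.1 i false
    by_contra hc
    rw [Bool.not_eq_false] at hc
    rw [hc] at h3
    linarith
  have hsink : ∀ i, C.OnSinkSide m i → y i = true := by
    intro i hi
    have h1 := hbel i
    have h2 := h.beliefMagnitude_pos_of_onSinkSide hC hno hx hN hi
    rw [side_of_onSinkSide hno hi] at h1
    have h3 := hy.1 i true
    by_contra hc
    rw [Bool.not_eq_true] at hc
    rw [hc] at h3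
    linarith
  have htie : ∀ i, ¬ C.OnSourceSide m i → ¬ C.OnSinkSide m i →
      C.belief (C.phase2Messages m φ x) i false = C.belief (C.phase2Messages m φ x) i true := by
    intro i h1 h2
    have h3 := hbel i
    rw [side, if_neg h1, if_neg h2] at h3
    linarith
  refine h.isMinimizer hC (fun i => ?_) fun d hf hs => ?_
  · split_ifs with hi
    · refine le_antisymm (not_lt.1 fun hc => ?_) (h.residualSource_nonneg i)
      rw [hsource i (onSourceSide_of_residualSource hc)] at hi
      cases hi
    · refine le_antisymm (not_lt.1 fun hc => ?_) (h.residualSink_nonneg i)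
      exact hi (hsink i (onSinkSide_of_residualSink hc))
  · refine le_antisymm (not_lt.1 fun hc => ?_) (h.residual_nonneg d)
    -- A residual dart cut by `y` has both ends outside both sides, hence tied beliefs; the
    -- tie-breaking rule then forbids the cut.
    have hf1 : ¬ C.OnSourceSide m d.fst := fun h1 => by
      rw [hsource _ (h1.snd hc)] at hs; cases hs
    have hs2 : ¬ C.OnSinkSide m d.snd := fun h1 => by
      rw [hsink _ (h1.fst hc)] at hf; cases hf
    have hf2 : ¬ C.OnSinkSide m d.fst := fun h1 => by
      rw [hsink _ h1] at hf; cases hf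
    have hs1 : ¬ C.OnSourceSide m d.snd := fun h1 => by
      rw [hsource _ h1] at hs; cases hs
    -- The flow is below capacity on `d` and at most capacity on the reverse; adding the two bounds
    -- makes the sum of the capacities positive.
    have heq := hy.2 d (htie _ hf1 hf2) (htie _ hs1 hs2) (by
      obtain ⟨h00, h11, h01, h10⟩ := hC.1 d
      rw [h.residual_eq] at hc
      have h1 := h.le_cap d.symm
      rw [h.symm, ← pair_true_false] at h1
      linarith)
    rw [hf, hs] at heq
    cases heq

/-! ### The run of the algorithm after Phase 1 -/

variable {S : ℕ → Messages G → Option (Chain G)}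

/-- The step that sets the flag leaves the messages alone, so at the first flagged time they still
encode the last flow of Phase 1. -/
theorem exists_isFlow_of_phase1Terminates (hC : C.IsCanonical) (hS : C.IsScheduler S)
    (hT : C.Phase1Terminates S) : ∃ (t : ℕ) (m : Messages G) (φ : G.Dart → ℝ),
      C.apmp S t = (m, true) ∧ C.IsFlow m φ ∧ ∀ T, ¬ C.IsAugmenting m T := by
  classical
  have h1 := Nat.find_spec hT
  have h2 : ∀ s < Nat.find hT, (C.apmp S s).2 = false := fun s hs => by
    simpa using Nat.find_min hT hs
  rcases ht : Nat.find hT with _ | t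
  · rw [ht] at h1; cases h1
  · rw [ht] at h1 h2
    have hf := h2 t t.lt_succ_self
    obtain ⟨φ, h, -, -⟩ := exists_isFlow_apmp (H := ⊤) hC hS (by simp) (by simp) hf
    rcases hs : S t (C.apmp S t).1 with _ | T
    · exact ⟨t + 1, _, φ, apmp_succ_of_none hf hs, h, (hS t _).2 hs⟩
    · rw [apmp_succ_of_some hf hs] at h1
      cases h1

theorem apmp_add_of_true {t : ℕ} (ht : C.apmp S t = (m, true)) (n : ℕ) :
    C.apmp S (t + n) = (C.strictMP^[n] m, true) := by
  induction n with
  | zero => exact ht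
  | succ n ih =>
    rw [← add_assoc, apmp_succ_of_true (by rw [ih]), ih, Function.iterate_succ_apply']

theorem exists_apmp_eq_isOptimalFixedPoint (hC : C.IsCanonical) (hS : C.IsScheduler S)
    (hT : C.Phase1Terminates S) : ∃ (m : Messages G) (K : ℕ),
      (∀ k ≥ K, C.apmp S k = (m, true)) ∧ C.IsOptimalFixedPoint m := by
  obtain ⟨t, m, φ, ht, h, hno⟩ := exists_isFlow_of_phase1Terminates hC hS hT
  obtain ⟨N, hN⟩ := h.exists_strictMP_isOptimalFixedPoint hC hno
  refine ⟨_, t + N, fun k hk => ?_, hN⟩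
  obtain ⟨n, rfl⟩ := Nat.exists_eq_add_of_le hk
  rw [add_assoc, apmp_add_of_true ht, add_comm N n, Function.iterate_add_apply,
    Function.iterate_fixed hN.1]

/-! ### The canonical form of a submodular energy -/

/-- Half of the preference of the pairwise potential for the label `0` at the start of the dart. -/
noncomputable def shift (E : PairwiseEnergy G) (d : G.Dart) : ℝ :=
  (E.pair d true true - E.pair d false false - E.pair d false true + E.pair d true false) / 2

/-- The energy obtained from `E` by moving the unary parts of the pairwise potentials to the unary
potentials. -/
noncomputable def canonicalForm (E : PairwiseEnergy G) : PairwiseEnergy G where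
  unary i := normalizeMsg fun a =>
    E.unary i a + if a = true then ∑ e : G.Dart with e.snd = i, E.shift e.symm else 0
  pair d a b := if a = b then 0 else
    (E.pair d false true + E.pair d true false - E.pair d false false - E.pair d true true) / 2
  pair_symm d a b := by
    simp only [E.pair_symm d, eq_comm (a := b)]
    split_ifs <;> ring

variable {E : PairwiseEnergy G}

theorem pair_eq_canonicalForm (E : PairwiseEnergy G) (d : G.Dart) (a b : Bool) :
    E.pair d a b = E.canonicalForm.pair d a b + (if a = true then E.shift d else 0) +
      (if b = true then E.shift d.symm else 0) + E.pair d false false := by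
  cases a <;> cases b <;> simp [canonicalForm, shift, E.pair_symm d] <;> ring

theorem canonicalForm_unary (E : PairwiseEnergy G) (i : V) (a : Bool) :
    E.unary i a = E.canonicalForm.unary i a + (E.unary i false - E.canonicalForm.unary i false) -
      if a = true then ∑ e : G.Dart with e.snd = i, E.shift e.symm else 0 := by
  cases a <;> simp [canonicalForm, normalizeMsg]

theorem isCanonical_canonicalForm (hE : E.IsSubmodular) : E.canonicalForm.IsCanonical := by
  refine ⟨fun d => ?_, fun i => ?_⟩
  · have := hE d
    refine ⟨by simp [canonicalForm], by simp [canonicalForm], ?_, ?_⟩ <;>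
      simp [canonicalForm] <;> linarith
  · exact normalizeMsg_nonneg fun a =>
      E.unary i a + if a = true then ∑ e : G.Dart with e.snd = i, E.shift e.symm else 0

theorem isReparametrization_canonicalForm (E : PairwiseEnergy G) :
    E.canonicalForm.IsReparametrization E := by
  refine ⟨∑ i, (E.unary i false - E.canonicalForm.unary i false) +
    1 / 2 * ∑ d : G.Dart, E.pair d false false, fun x => ?_⟩
  have h1 := sum_dart_snd (fun d => E.shift d.symm) x
  have h2 := sum_dart_symm (fun d : G.Dart => if x d.snd = true then E.shift d.symm else 0)
  simp only [SimpleGraph.Dart.symm_symm] at h2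
  change ∑ d : G.Dart, (if x d.fst = true then E.shift d else 0) = _ at h2
  rw [energy, energy]
  simp only [pair_eq_canonicalForm E _ (x _), canonicalForm_unary E _ (x _),
    Finset.sum_add_distrib, Finset.sum_sub_distrib]
  rw [h2, h1]
  ring

/-- The messages of `E` that correspond to the messages `m` of its canonical form. -/
noncomputable def unshiftMessages (E : PairwiseEnergy G) (m : Messages G) : Messages G where
  unary := E.unaryUpdate
  toFactor d := ofDiff (m.toFactor d true - m.toFactor d false - E.shift d)
  toVar d := ofDiff (m.toVar d true - m.toVar d false + E.shift d.symm)

theorem belief_sub_unshiftMessages (E : PairwiseEnergy G) (m : Messages G) (i : V) :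
    E.belief (E.unshiftMessages m) i true - E.belief (E.unshiftMessages m) i false =
      E.canonicalForm.belief m i true - E.canonicalForm.belief m i false := by
  have := canonicalForm_unary E i true
  rw [if_pos rfl] at this
  rw [belief_sub, belief_sub]
  simp only [unshiftMessages, ofDiff_sub, Finset.sum_add_distrib]
  linarith

theorem excess_eq_belief_sub {m : Messages G} (hm : m.unary = E.unaryUpdate) (i : V) :
    m.excess i = E.belief m i true - E.belief m i false := by
  rw [belief_sub, Messages.excess, hm, unaryUpdate, normalizeMsg_eq_ofDiff, ofDiff_sub]

/-- Moving a unary term out of a pairwise potential changes the message to that variable by this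
term and the message from it by the negative. The differences of the beliefs stay the same, and so
do the fixed-point equations. -/
theorem isMPFixedPoint_unshiftMessages {m : Messages G}
    (hm : E.canonicalForm.IsMPFixedPoint m) : E.IsMPFixedPoint (E.unshiftMessages m) := by
  have hu : m.unary = E.canonicalForm.unaryUpdate := congrArg Messages.unary hm.symm
  have hf : ∀ d, E.canonicalForm.toFactorUpdate m d = m.toFactor d := fun d =>
    congrFun (congrArg Messages.toFactor hm) d
  have hv : ∀ d, E.canonicalForm.toVarUpdate m d = m.toVar d := fun d =>
    congrFun (congrArg Messages.toVar hm) d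
  refine Messages.ext rfl ?_ ?_
  · funext d
    show E.toFactorUpdate _ d = ofDiff (_ - _ - E.shift d)
    rw [toFactorUpdate_eq, excess_eq_belief_sub (E := E) rfl, belief_sub_unshiftMessages,
      ← excess_eq_belief_sub hu, ← hf d, toFactorUpdate_eq, ofDiff_sub]
    simp only [unshiftMessages, ofDiff_sub, SimpleGraph.Dart.symm_symm]
    congr 1; ring
  · funext d
    show E.toVarUpdate _ d = ofDiff (_ - _ + E.shift d.symm)
    rw [← hv d, toVarUpdate, toVarUpdate, normalizeMsg_eq_ofDiff, normalizeMsg_eq_ofDiff,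
      ofDiff_sub]
    congr 1
    -- The correction does not depend on `a`, so it leaves the minimum; its part independent of `b`
    -- disappears in the difference.
    have key : ∀ a b, E.pair d a b + (E.unshiftMessages m).toFactor d a =
        E.canonicalForm.pair d a b + m.toFactor d a + ((if b = true then E.shift d.symm else 0) +
        (E.pair d false false + ((E.unshiftMessages m).toFactor d false - m.toFactor d false))) := by
      intro a b
      have h1 : (E.unshiftMessages m).toFactor d true - (E.unshiftMessages m).toFactor d false =
        m.toFactor d true - m.toFactor d false - E.shift d := ofDiff_sub _
      rw [pair_eq_canonicalForm E d a b]
      cases a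
      · simp; ring
      · simp; linarith
    simp only [key, min_add_add_right]
    simp; ring

/-- Beliefs change by a constant at each variable, and the submodularity gap of each edge is
unchanged, so the minimizing labels and the tie-breaking rule are the same. -/
theorem isDecoding_unshiftMessages_iff (E : PairwiseEnergy G) (m : Messages G) (x : V → Bool) :
    E.IsDecoding (E.unshiftMessages m) x ↔ E.canonicalForm.IsDecoding m x := by
  have key : ∀ i a, E.belief (E.unshiftMessages m) i a = E.canonicalForm.belief m i a +
      (E.belief (E.unshiftMessages m) i false - E.canonicalForm.belief m i false) := by
    intro i a
    have := belief_sub_unshiftMessages E m i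
    cases a <;> linarith
  have hgap : ∀ d, E.pair d false false + E.pair d true true <
      E.pair d false true + E.pair d true false ↔
      E.canonicalForm.pair d false false + E.canonicalForm.pair d true true <
      E.canonicalForm.pair d false true + E.canonicalForm.pair d true false := by
    intro d
    simp only [canonicalForm]
    simp
    constructor <;> intro h <;> linarith
  rw [IsDecoding, IsDecoding]
  refine and_congr (forall_congr' fun i => forall_congr' fun a => ?_)
    (forall_congr' fun d => ?_)
  · rw [key i (x i), key i a]
    exact add_le_add_iff_right _
  · rw [hgap, key d.fst true, key d.snd true]
    constructor <;> intro h h1 h2 <;> exact h (by linarith) (by linarith)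

theorem IsReparametrization.isMinimizer {C : PairwiseEnergy G} (h : C.IsReparametrization E)
    {x : V → Bool} (hx : C.IsMinimizer x) : E.IsMinimizer x := by
  obtain ⟨c, hc⟩ := h
  intro y
  rw [hc, hc]
  linarith [hx y]

theorem isOptimalFixedPoint_unshiftMessages {m : Messages G}
    (hm : E.canonicalForm.IsOptimalFixedPoint m) :
    E.IsOptimalFixedPoint (E.unshiftMessages m) :=
  ⟨isMPFixedPoint_unshiftMessages hm.1, exists_isDecoding _ _, fun x hx =>
    (isReparametrization_canonicalForm E).isMinimizer
      (hm.2.2 x ((isDecoding_unshiftMessages_iff E m x).1 hx))⟩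

end PairwiseEnergy

theorem mainTheorem2 {V : Type*} [Fintype V] [DecidableEq V] (G : SimpleGraph V)
    [DecidableRel G.Adj] (E : PairwiseEnergy G) (hE : E.IsSubmodular) :
    (∃ C : PairwiseEnergy G, C.IsCanonical ∧ C.IsReparametrization E) ∧
    (∀ C : PairwiseEnergy G, C.IsCanonical → C.IsReparametrization E →
      (∃ S, C.IsScheduler S ∧ C.IsShortestPath S) ∧
      (∀ S, C.IsScheduler S → C.IsShortestPath S ∨ C.IsRational → C.Phase1Terminates S) ∧
      (∀ S, C.IsScheduler S → C.Phase1Terminates S →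
        ∃ (m : Messages G) (K : ℕ), (∀ k ≥ K, C.apmp S k = (m, true)) ∧
          C.IsOptimalFixedPoint m ∧ ∀ x, C.IsDecoding m x → E.IsMinimizer x)) ∧
    (∃ m : Messages G, E.IsOptimalFixedPoint m) := by
  have hcan := PairwiseEnergy.isCanonical_canonicalForm hE
  refine ⟨⟨_, hcan, E.isReparametrization_canonicalForm⟩, fun C hC hCE =>
    ⟨C.exists_scheduler, fun S hS h => ?_, fun S hS hT => ?_⟩, ?_⟩
  · rcases h with h | h
    · exact PairwiseEnergy.phase1Terminates_of_isShortestPath hC hS h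
    · exact PairwiseEnergy.phase1Terminates_of_isRational hC hS h
  · obtain ⟨m, K, hK, hm⟩ := PairwiseEnergy.exists_apmp_eq_isOptimalFixedPoint hC hS hT
    exact ⟨m, K, hK, hm, fun x hx => hCE.isMinimizer (hm.2.2 x hx)⟩
  · obtain ⟨S, hS, hshort⟩ := E.canonicalForm.exists_scheduler
    obtain ⟨m, K, -, hm⟩ := PairwiseEnergy.exists_apmp_eq_isOptimalFixedPoint hcan hS
      (PairwiseEnergy.phase1Terminates_of_isShortestPath hcan hS hshort)
    exact ⟨_, PairwiseEnergy.isOptimalFixedPoint_unshiftMessages hm⟩
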